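/- Let $p,q,n\ge 1$ be integers. For integers $a,b\ge 1$ let $F_{a,b,n}$ be the Segal--Bargmann (Fock) space of entire functions $\psi(z_1,\dots,z_a,z'_1,\dots,z'_b)$ of the vectors $z_i=(z_{k,i})_{k=1}^n$, $z'_j=(z'_{k,j})_{k=1}^n\in\mathbb{C}^n$ with $$\|\psi\|^2=\frac1{\pi^{n(a+b)}}\int e^{-|z|^2-|z'|^2}|\psi(z,z')|^2\,\mathrm dz\,\mathrm dz'<\infty ,$$ with the corresponding inner product. For $u\in U(n)$ let $W_u$ be the unitary operator $(W_u\psi)(z_1,\dots,z_a,z'_1,\dots,z'_b)=\psi(uz_1,\dots,uz_a,\overline u z'_1,\dots,\overline u z'_b)$, and let $F_{a,b,n}^{U(n)}=\{\psi\in F_{a,b,n}: W_u\psi=\psi\ \ \forall u\in U(n)\}$. Identify $F_{p+q,p+q,n}$ with $F_{p,q,n}\otimes F_{q,p,n}$, where the first factor (the system) carries the variables $z_1,\dots,z_p,z'_1,\dots,z'_q$ and the second one (the reference) carries the variables $z_{p+1},\dots,z_{p+q},z'_{q+1},\dots,z'_{q+p}$, and $f\otimes g$ is the product of functions. Theorem.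 Let $\rho$ be a density operator on $F_{p,q,n}$ (a bounded positive semidefinite operator of trace $1$) such that $W_u\rho W_u^\dagger=\rho$ for all $u\in U(n)$. Then $\rho$ has a purification in the symmetric subspace: there is $\psi\in F_{p+q,p+q,n}^{U(n)}$ such that the partial trace of $|\psi\rangle\langle\psi|$ over the reference factor $F_{q,p,n}$ equals $\rho$. Moreover $\psi$ can be taken to be the norm limit $$\psi=\lim_{d\to\infty}\bigl(\sqrt{\rho^{\le d}}\otimes 1\bigr)\,\Phi^{\le d},\qquad \Phi^{\le d}=\sum_{m=0}^d\frac1{m!}\Bigl(\sum_{i=1}^p Z_{i,q+i}+\sum_{j=1}^q Z_{p+j,j}\Bigr)^m,\qquad Z_{i,j}=\sum_{k=1}^n z_{k,i}z'_{k,j},$$ where $\rho^{\le d}=\Pi^{\le d}\rho\,\Pi^{\le d}$ and $\Pi^{\le d}$ is the orthogonal projection of $F_{p,q,n}$ onto the polynomials of total degree at most $d$. -/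

import Mathlib

open MeasureTheory Filter Topology

noncomputable section

namespace SegalBargmann

/-! ### The Segal-Bargmann space over a finite set `ι` of modes -/

/-- The Gaussian weight `π^{-|ι|} exp (-∑ |z_i|²)` on `ℂ^ι`. -/
def weight {ι : Type} [Fintype ι] (z : ι → ℂ) : ℝ :=
  (Real.pi ^ Fintype.card ι)⁻¹ * Real.exp (-∑ i, ‖z i‖ ^ 2)

theorem weight_pos {ι : Type} [Fintype ι] (z : ι → ℂ) : 0 < weight z := by
  unfold weight; positivity

theorem continuous_weight {ι : Type} [Fintype ι] :
    Continuous (weight : (ι → ℂ) → ℝ) := by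
  unfold weight; fun_prop

theorem weight_eq_prod {ι : Type} [Fintype ι] (z : ι → ℂ) :
    weight z = ∏ i, (Real.pi⁻¹ * Real.exp (-‖z i‖ ^ 2)) := by
  simp [weight, Finset.prod_mul_distrib, ← Real.exp_sum, Finset.sum_neg_distrib]

/-- Membership in the Segal-Bargmann space: `ψ` is entire and square-integrable with respect to the
Gaussian measure `weight z dz`, where `dz` is Lebesgue measure on `ℂ^ι`. -/
structure IsState {ι : Type} [Fintype ι] (ψ : (ι → ℂ) → ℂ) : Prop where
  differentiable : Differentiable ℂ ψ
  integrable : Integrable (fun z => ‖ψ z‖ ^ 2 * weight z)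

theorem IsState.integrable_mul {ι : Type} [Fintype ι] {φ ψ : (ι → ℂ) → ℂ}
    (hφ : IsState φ) (hψ : IsState ψ) :
    Integrable (fun z => (starRingEnd ℂ) (φ z) * ψ z * (weight z : ℂ)) := by
  have hc1 := hφ.differentiable.continuous
  have hc2 := hψ.differentiable.continuous
  have hw := continuous_weight (ι := ι)
  refine (hφ.integrable.add hψ.integrable).mono'
    (by apply Continuous.aestronglyMeasurable; fun_prop) (.of_forall fun z => ?_)
  have h := weight_pos z
  simp only [norm_mul, RCLike.norm_conj, Complex.norm_real, Real.norm_eq_abs, abs_of_pos h,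
    Pi.add_apply]
  rw [← add_mul]
  refine mul_le_mul_of_nonneg_right ?_ h.le
  nlinarith [sq_nonneg (‖φ z‖ - ‖ψ z‖), sq_nonneg (‖φ z‖), sq_nonneg (‖ψ z‖)]

/-- The entire functions that are square-integrable for the Gaussian measure, as a linear space. -/
def stateSubmodule (ι : Type) [Fintype ι] : Submodule ℂ ((ι → ℂ) → ℂ) where
  carrier := {ψ | IsState ψ}
  zero_mem' := ⟨differentiable_const 0, by simp⟩
  add_mem' := by
    intro φ ψ hφ hψ
    refine ⟨hφ.differentiable.add hψ.differentiable, ?_⟩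
    have hc1 := hφ.differentiable.continuous
    have hc2 := hψ.differentiable.continuous
    have hw := continuous_weight (ι := ι)
    have hc3 : Continuous (φ + ψ) := hc1.add hc2
    refine ((hφ.integrable.add hψ.integrable).const_mul 2).mono'
      (by apply Continuous.aestronglyMeasurable; fun_prop)
      (.of_forall fun z => ?_)
    have h := weight_pos z
    simp only [Pi.add_apply, norm_mul, norm_pow, Real.norm_eq_abs, abs_of_pos h,
      abs_of_nonneg (norm_nonneg _)]
    rw [← add_mul, ← mul_assoc]
    refine mul_le_mul_of_nonneg_right ?_ h.le
    have := norm_add_le (φ z) (ψ z)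
    nlinarith [sq_nonneg (‖φ z‖ - ‖ψ z‖), norm_nonneg (φ z + ψ z), norm_nonneg (φ z),
      norm_nonneg (ψ z)]
  smul_mem' := by
    intro c ψ hψ
    refine ⟨hψ.differentiable.const_smul c, ?_⟩
    have := hψ.integrable.const_mul (‖c‖ ^ 2)
    refine this.congr (.of_forall fun z => ?_)
    simp only [Pi.smul_apply, smul_eq_mul, norm_mul]
    ring

/-- The Segal-Bargmann space `L²_hol(ℂ^ι)`. It is a type of its own, so that its topology is the
one of the norm and not the one of pointwise convergence. -/
def SBSpace (ι : Type) [Fintype ι] : Type := stateSubmodule ι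

instance instAddCommGroupSBSpace (ι : Type) [Fintype ι] : AddCommGroup (SBSpace ι) :=
  inferInstanceAs (AddCommGroup (stateSubmodule ι))

instance instModuleSBSpace (ι : Type) [Fintype ι] : Module ℂ (SBSpace ι) :=
  inferInstanceAs (Module ℂ (stateSubmodule ι))

/-- The function underlying an element of the Segal-Bargmann space. -/
def SBSpace.toFun {ι : Type} [Fintype ι] (ψ : SBSpace ι) : (ι → ℂ) → ℂ :=
  Subtype.val (p := fun ψ => ψ ∈ stateSubmodule ι) ψ

instance instCoeFunSBSpace (ι : Type) [Fintype ι] :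
    CoeFun (SBSpace ι) (fun _ => (ι → ℂ) → ℂ) where
  coe := SBSpace.toFun

/-- The element of the Segal-Bargmann space given by a function. -/
def mkState {ι : Type} [Fintype ι] (ψ : (ι → ℂ) → ℂ) (h : IsState ψ) : SBSpace ι :=
  Subtype.mk (p := fun ψ => ψ ∈ stateSubmodule ι) ψ h

theorem mkState_apply {ι : Type} [Fintype ι] (ψ : (ι → ℂ) → ℂ) (h : IsState ψ) (z : ι → ℂ) :
    mkState ψ h z = ψ z := rfl

theorem isState_coe {ι : Type} [Fintype ι] (ψ : SBSpace ι) : IsState (ψ : (ι → ℂ) → ℂ) :=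
  Subtype.property (p := fun ψ => ψ ∈ stateSubmodule ι) ψ

theorem sb_ext {ι : Type} [Fintype ι] {φ ψ : SBSpace ι} (h : ∀ z, φ z = ψ z) : φ = ψ :=
  Subtype.ext (funext h)

theorem sb_add_apply {ι : Type} [Fintype ι] (φ ψ : SBSpace ι) (z : ι → ℂ) :
    (φ + ψ) z = φ z + ψ z := rfl

theorem sb_smul_apply {ι : Type} [Fintype ι] (c : ℂ) (ψ : SBSpace ι) (z : ι → ℂ) :
    (c • ψ) z = c * ψ z := rfl

/-- The inner product `⟨φ, ψ⟩ = π^{-|ι|} ∫ exp(-|z|²) conj(φ(z)) ψ(z) dz`. -/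
abbrev sbCore (ι : Type) [Fintype ι] : InnerProductSpace.Core ℂ (SBSpace ι) where
  inner φ ψ := ∫ z : ι → ℂ, (starRingEnd ℂ) (φ z) * ψ z * (weight z : ℂ)
  conj_inner_symm φ ψ := by
    rw [← integral_conj]
    refine integral_congr_ae (.of_forall fun z => ?_)
    simp only [map_mul, Complex.conj_conj, Complex.conj_ofReal]
    ring
  re_inner_nonneg ψ := by
    have h : (fun z => (starRingEnd ℂ) (ψ z) * ψ z * (weight z : ℂ)) =
        fun z => ((‖ψ z‖ ^ 2 * weight z : ℝ) : ℂ) := by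
      funext z; rw [Complex.conj_mul']; push_cast; rfl
    rw [h, integral_complex_ofReal, RCLike.re_to_complex, Complex.ofReal_re]
    exact integral_nonneg fun z => mul_nonneg (sq_nonneg _) (weight_pos z).le
  add_left φ φ' ψ := by
    rw [← integral_add ((isState_coe φ).integrable_mul (isState_coe ψ))
      ((isState_coe φ').integrable_mul (isState_coe ψ))]
    refine integral_congr_ae (.of_forall fun z => ?_)
    simp only [sb_add_apply, map_add]
    ring
  smul_left φ ψ c := by
    rw [← integral_const_mul]
    refine integral_congr_ae (.of_forall fun z => ?_)
    simp only [sb_smul_apply, map_mul]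
    ring
  definite ψ h0 := by
    have h : (fun z => (starRingEnd ℂ) (ψ z) * ψ z * (weight z : ℂ)) =
        fun z => ((‖ψ z‖ ^ 2 * weight z : ℝ) : ℂ) := by
      funext z; rw [Complex.conj_mul']; push_cast; rfl
    rw [h, integral_complex_ofReal] at h0
    have h1 : ∫ z, ‖ψ z‖ ^ 2 * weight z = 0 := by exact_mod_cast h0
    rw [integral_eq_zero_iff_of_nonneg
      (fun z => mul_nonneg (sq_nonneg _) (weight_pos z).le) (isState_coe ψ).integrable] at h1
    have hc := (isState_coe ψ).differentiable.continuous
    have hw := continuous_weight (ι := ι)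
    have h2 := (Continuous.ae_eq_iff_eq volume ((hc.norm.pow 2).mul hw) continuous_const).1 h1
    refine sb_ext fun z => ?_
    have h3 := congrFun h2 z
    change ψ z = 0
    have h4 : ‖ψ z‖ ^ 2 * weight z = 0 := h3
    simpa [(weight_pos z).ne'] using h4

instance instNormedAddCommGroupSBSpace (ι : Type) [Fintype ι] : NormedAddCommGroup (SBSpace ι) :=
  (sbCore ι).toNormedAddCommGroup

instance instInnerProductSpaceSBSpace (ι : Type) [Fintype ι] : InnerProductSpace ℂ (SBSpace ι) :=
  InnerProductSpace.ofCore (sbCore ι).toCore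

theorem sb_inner_def {ι : Type} [Fintype ι] (φ ψ : SBSpace ι) :
    inner ℂ φ ψ = ∫ z : ι → ℂ, (starRingEnd ℂ) (φ z) * ψ z * (weight z : ℂ) := rfl

/-! ### Polynomials -/

theorem integrable_monomial_one (k : ℕ) :
    Integrable (fun z : ℂ => ‖z‖ ^ k * (Real.pi⁻¹ * Real.exp (-‖z‖ ^ 2))) := by
  have h : Integrable (fun z : ℂ => ‖z‖ ^ (k : ℝ) * Real.exp (-‖z‖ ^ (2 : ℝ))) := by
    by_contra hn
    have h1 := Complex.integral_rpow_mul_exp_neg_rpow (p := 2) (q := k) (by norm_num)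
      (by have : (0 : ℝ) ≤ k := Nat.cast_nonneg k
          linarith)
    rw [integral_undef hn] at h1
    have : 0 < Real.Gamma (((k : ℝ) + 2) / 2) := Real.Gamma_pos_of_pos (by positivity)
    have : 0 < (2 * Real.pi / 2) * Real.Gamma (((k : ℝ) + 2) / 2) := by positivity
    exact this.ne h1
  refine (h.const_mul Real.pi⁻¹).congr (.of_forall fun z => ?_)
  simp only [Real.rpow_natCast, Real.rpow_two]
  ring

theorem isState_polynomial {ι : Type} [Fintype ι] (P : MvPolynomial ι ℂ) :
    IsState (fun z => MvPolynomial.eval z P) := by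
  classical
  have hmono : ∀ (s : ι →₀ ℕ), (fun z : ι → ℂ => ∏ i, z i ^ s i) ∈ stateSubmodule ι := by
    intro s
    refine ⟨by fun_prop, ?_⟩
    have h := Integrable.fintype_prod (μ := fun _ : ι => (volume : Measure ℂ))
      (f := fun i (x : ℂ) => ‖x‖ ^ (2 * s i) * (Real.pi⁻¹ * Real.exp (-‖x‖ ^ 2)))
      (fun i => integrable_monomial_one (2 * s i))
    refine h.congr (.of_forall fun z => ?_)
    simp only [weight_eq_prod, norm_prod, norm_pow, ← Finset.prod_pow, Finset.prod_mul_distrib]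
    congr 1
    refine Finset.prod_congr rfl fun i _ => ?_
    rw [← pow_mul, mul_comm]
  have key : (fun z => MvPolynomial.eval z P) =
      ∑ s ∈ P.support, P.coeff s • (fun z : ι → ℂ => ∏ i, z i ^ s i) := by
    funext z
    rw [MvPolynomial.eval_eq']
    simp
  have hmem : (fun z => MvPolynomial.eval z P) ∈ stateSubmodule ι := by
    rw [key]
    exact Submodule.sum_mem _ fun s _ => Submodule.smul_mem _ _ (hmono s)
  exact hmem

/-- A polynomial, seen as an element of the Segal-Bargmann space. -/
def polyState (ι : Type) [Fintype ι] : MvPolynomial ι ℂ →ₗ[ℂ] SBSpace ι where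
  toFun P := mkState (fun z => MvPolynomial.eval z P) (isState_polynomial P)
  map_add' P Q := sb_ext fun z => map_add (MvPolynomial.eval z) P Q
  map_smul' c P := sb_ext fun z => by
    simp [sb_smul_apply, mkState_apply]

/-- The finite-dimensional subspace of polynomials of total degree at most `d`. -/
def degreeLE (ι : Type) [Fintype ι] (d : ℕ) : Submodule ℂ (SBSpace ι) :=
  (MvPolynomial.restrictTotalDegree ι ℂ d).map (polyState ι)

instance instFiniteDegreeLE (ι : Type) [Fintype ι] (d : ℕ) :
    FiniteDimensional ℂ (degreeLE ι d) := by
  unfold degreeLE; infer_instance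

instance instProjDegreeLE (ι : Type) [Fintype ι] (d : ℕ) :
    (degreeLE ι d).HasOrthogonalProjection :=
  haveI : CompleteSpace (degreeLE ι d) := FiniteDimensional.complete ℂ _
  inferInstance

/-! ### Unitary changes of variables -/

theorem measurePreserving_of_norm {ι : Type} [Fintype ι] (L : (ι → ℂ) ≃ₗ[ℂ] (ι → ℂ))
    (hL : ∀ z, ∑ i, ‖L z i‖ ^ 2 = ∑ i, ‖z i‖ ^ 2) : MeasurePreserving (L : (ι → ℂ) → (ι → ℂ)) := by
  have hcont : Continuous (L : (ι → ℂ) → (ι → ℂ)) :=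
    LinearMap.continuous_of_finiteDimensional L.toLinearMap
  refine ⟨hcont.measurable, ?_⟩
  have hdet : LinearMap.det ((L.restrictScalars ℝ : (ι → ℂ) ≃ₗ[ℝ] (ι → ℂ)) :
      (ι → ℂ) →ₗ[ℝ] (ι → ℂ)) ≠ 0 := (LinearEquiv.isUnit_det' _).ne_zero
  have hmap := Measure.map_linearMap_addHaar_eq_smul_addHaar
    (volume : Measure (ι → ℂ)) hdet
  set c := ENNReal.ofReal |(LinearMap.det ((L.restrictScalars ℝ : (ι → ℂ) ≃ₗ[ℝ] (ι → ℂ)) :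
      (ι → ℂ) →ₗ[ℝ] (ι → ℂ)))⁻¹|
  have hmap' : Measure.map (L : (ι → ℂ) → (ι → ℂ)) volume = c • volume := hmap
  have hwm : Measurable fun z : ι → ℂ => ENNReal.ofReal (weight z) :=
    continuous_weight.measurable.ennreal_ofReal
  have h1 : ∫⁻ z, ENNReal.ofReal (weight z) ∂(Measure.map (L : (ι → ℂ) → (ι → ℂ)) volume) =
      ∫⁻ z : ι → ℂ, ENNReal.ofReal (weight z) := by
    rw [lintegral_map hwm hcont.measurable]
    refine lintegral_congr fun z => ?_
    simp only [weight, hL]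
  have hint : Integrable (weight : (ι → ℂ) → ℝ) := by
    have := (isState_polynomial (1 : MvPolynomial ι ℂ)).integrable
    simpa using this
  have hfin : ∫⁻ z : ι → ℂ, ENNReal.ofReal (weight z) ≠ ⊤ := hint.lintegral_lt_top.ne
  have hne : ∫⁻ z : ι → ℂ, ENNReal.ofReal (weight z) ≠ 0 := by
    rw [Ne, lintegral_eq_zero_iff hwm]
    intro h
    have h2 := (Continuous.ae_eq_iff_eq volume
      (ENNReal.continuous_ofReal.comp continuous_weight) continuous_const).1 h
    have h3 := congrFun h2 (0 : ι → ℂ)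
    have h4 := weight_pos (0 : ι → ℂ)
    exact h4.not_ge (ENNReal.ofReal_eq_zero.1 h3)
  rw [hmap', lintegral_smul_measure, smul_eq_mul] at h1
  have hc : c = 1 := by
    have h5 : c * (∫⁻ z : ι → ℂ, ENNReal.ofReal (weight z)) =
      1 * ∫⁻ z : ι → ℂ, ENNReal.ofReal (weight z) := by rw [h1, one_mul]
    exact (ENNReal.mul_left_inj hne hfin).1 h5
  rw [hmap', hc, one_smul]

theorem isState_comp {ι : Type} [Fintype ι] (L : (ι → ℂ) ≃ₗ[ℂ] (ι → ℂ))
    (hL : ∀ z, ∑ i, ‖L z i‖ ^ 2 = ∑ i, ‖z i‖ ^ 2) {ψ : (ι → ℂ) → ℂ} (hψ : IsState ψ) :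
    IsState (fun z => ψ (L z)) := by
  have hd : Differentiable ℂ (L : (ι → ℂ) → (ι → ℂ)) :=
    (LinearMap.toContinuousLinearMap L.toLinearMap).differentiable
  refine ⟨hψ.differentiable.comp hd, ?_⟩
  have h := (measurePreserving_of_norm L hL).integrable_comp_of_integrable hψ.integrable
  refine h.congr (.of_forall fun z => ?_)
  simp only [Function.comp, weight, hL]

/-- The unitary operator `ψ ↦ ψ ∘ L` for a unitary change of variables `L`. -/
def compUnitary {ι : Type} [Fintype ι] (L : (ι → ℂ) ≃ₗ[ℂ] (ι → ℂ))
    (hL : ∀ z, ∑ i, ‖L z i‖ ^ 2 = ∑ i, ‖z i‖ ^ 2) : SBSpace ι ≃ₗᵢ[ℂ] SBSpace ι :=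
  LinearEquiv.isometryOfInner
    { toFun := fun ψ => mkState (fun z => ψ (L z)) (isState_comp L hL (isState_coe ψ))
      map_add' := fun _ _ => rfl
      map_smul' := fun _ _ => rfl
      invFun := fun ψ => mkState (fun z => ψ (L.symm z))
        (isState_comp L.symm (fun z => by rw [← hL (L.symm z), L.apply_symm_apply])
          (isState_coe ψ))
      left_inv := fun ψ => sb_ext fun z => by simp [mkState_apply]
      right_inv := fun ψ => sb_ext fun z => by simp [mkState_apply] }
    (by
      intro φ ψ
      simp only [sb_inner_def]
      have hmp := measurePreserving_of_norm L hL
      have hemb : MeasurableEmbedding (L : (ι → ℂ) → (ι → ℂ)) :=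
        (LinearEquiv.toContinuousLinearEquiv L).toHomeomorph.measurableEmbedding
      rw [← hmp.integral_comp hemb
        (fun z => (starRingEnd ℂ) (φ z) * ψ z * (weight z : ℂ))]
      refine integral_congr_ae (.of_forall fun z => ?_)
      have hw : weight (L z) = weight z := by simp only [weight, hL]
      simp only [hw]
      rfl)

/-! ### The Fock space `F_{p,q,n}` and the action of `U(n)` -/

/-- The modes of `F_{p,q,n}`: `inl (k, i)` stands for the variable `z_{k,i}` and `inr (k, j)` for
the variable `z'_{k,j}`. -/
abbrev Modes (p q n : ℕ) : Type := (Fin n × Fin p) ⊕ (Fin n × Fin q)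

/-- The Fock space `F_{p,q,n}` in the Segal-Bargmann representation. -/
abbrev Fock (p q n : ℕ) : Type := SBSpace (Modes p q n)

/-- The change of variables `(z_i, z'_j) ↦ (u z_i, v z'_j)`. -/
def blockMul {p q n : ℕ} (u v : Matrix (Fin n) (Fin n) ℂ) :
    (Modes p q n → ℂ) →ₗ[ℂ] (Modes p q n → ℂ) where
  toFun z := Sum.elim (fun a => u.mulVec (fun l => z (Sum.inl (l, a.2))) a.1)
    (fun b => v.mulVec (fun l => z (Sum.inr (l, b.2))) b.1)
  map_add' z w := by
    ext (a | b)
    · exact congrFun (Matrix.mulVec_add u (fun l => z (Sum.inl (l, a.2)))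
        (fun l => w (Sum.inl (l, a.2)))) a.1
    · exact congrFun (Matrix.mulVec_add v (fun l => z (Sum.inr (l, b.2)))
        (fun l => w (Sum.inr (l, b.2)))) b.1
  map_smul' c z := by
    ext (a | b)
    · exact congrFun (Matrix.mulVec_smul u c (fun l => z (Sum.inl (l, a.2)))) a.1
    · exact congrFun (Matrix.mulVec_smul v c (fun l => z (Sum.inr (l, b.2)))) b.1

theorem blockMul_comp {p q n : ℕ} (u v u' v' : Matrix (Fin n) (Fin n) ℂ) (hu : u * u' = 1)
    (hv : v * v' = 1) (z : Modes p q n → ℂ) : blockMul u v (blockMul u' v' z) = z := by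
  ext (a | b)
  · change u.mulVec (u'.mulVec (fun l => z (Sum.inl (l, a.2)))) a.1 = _
    rw [Matrix.mulVec_mulVec, hu, Matrix.one_mulVec]
  · change v.mulVec (v'.mulVec (fun l => z (Sum.inr (l, b.2)))) b.1 = _
    rw [Matrix.mulVec_mulVec, hv, Matrix.one_mulVec]

theorem norm_mulVec_unitary {n : ℕ} (u : Matrix (Fin n) (Fin n) ℂ) (hu : star u * u = 1)
    (x : Fin n → ℂ) : ∑ k, ‖u.mulVec x k‖ ^ 2 = ∑ k, ‖x k‖ ^ 2 := by
  have h : ∀ y : Fin n → ℂ, ((∑ k, ‖y k‖ ^ 2 : ℝ) : ℂ) = dotProduct (star y) y := by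
    intro y
    simp only [dotProduct, Pi.star_apply, RCLike.star_def, Complex.conj_mul']
    push_cast
    rfl
  have h2 : dotProduct (star (u.mulVec x)) (u.mulVec x) = dotProduct (star x) x := by
    rw [Matrix.star_mulVec, Matrix.dotProduct_mulVec, Matrix.vecMul_vecMul,
      ← Matrix.star_eq_conjTranspose, hu, Matrix.vecMul_one]
  have h3 := (h (u.mulVec x)).trans (h2.trans (h x).symm)
  exact_mod_cast h3

theorem blockMul_norm {p q n : ℕ} (u v : Matrix (Fin n) (Fin n) ℂ) (hu : star u * u = 1)
    (hv : star v * v = 1) (z : Modes p q n → ℂ) :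
    ∑ i, ‖blockMul u v z i‖ ^ 2 = ∑ i, ‖z i‖ ^ 2 := by
  simp only [Fintype.sum_sum_type, Fintype.sum_prod_type_right]
  congr 1
  · exact Finset.sum_congr rfl fun i _ => norm_mulVec_unitary u hu (fun l => z (Sum.inl (l, i)))
  · exact Finset.sum_congr rfl fun i _ => norm_mulVec_unitary v hv (fun l => z (Sum.inr (l, i)))

/-- The entrywise complex conjugate of a matrix. -/
def conjMat {n : ℕ} (u : Matrix (Fin n) (Fin n) ℂ) : Matrix (Fin n) (Fin n) ℂ :=
  u.map (starRingEnd ℂ)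

theorem conjMat_mul {n : ℕ} (u v : Matrix (Fin n) (Fin n) ℂ) (h : u * v = 1) :
    conjMat u * conjMat v = 1 := by
  unfold conjMat
  rw [← Matrix.map_mul, h]
  exact Matrix.map_one _ (map_zero _) (map_one _)

theorem conjMat_star {n : ℕ} (u : Matrix (Fin n) (Fin n) ℂ) :
    conjMat (star u) = star (conjMat u) := by
  ext i j
  simp [conjMat, Matrix.star_apply]

/-- The change of variables `(z_i, z'_j) ↦ (u z_i, ū z'_j)` for `u ∈ U(n)`. -/
def unitaryAct (p q : ℕ) {n : ℕ} (u : Matrix.unitaryGroup (Fin n) ℂ) :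
    (Modes p q n → ℂ) ≃ₗ[ℂ] (Modes p q n → ℂ) where
  __ := blockMul (u : Matrix (Fin n) (Fin n) ℂ) (conjMat u)
  invFun := blockMul (star (u : Matrix (Fin n) (Fin n) ℂ)) (conjMat (star u.1))
  left_inv z := blockMul_comp _ _ _ _ (Matrix.mem_unitaryGroup_iff'.1 u.2)
    (conjMat_mul _ _ (Matrix.mem_unitaryGroup_iff'.1 u.2)) z
  right_inv z := blockMul_comp _ _ _ _ (Matrix.mem_unitaryGroup_iff.1 u.2)
    (conjMat_mul _ _ (Matrix.mem_unitaryGroup_iff.1 u.2)) z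

theorem unitaryAct_norm (p q : ℕ) {n : ℕ} (u : Matrix.unitaryGroup (Fin n) ℂ)
    (z : Modes p q n → ℂ) : ∑ i, ‖unitaryAct p q u z i‖ ^ 2 = ∑ i, ‖z i‖ ^ 2 :=
  blockMul_norm _ _ (Matrix.mem_unitaryGroup_iff'.1 u.2)
    (by rw [← conjMat_star]; exact conjMat_mul _ _ (Matrix.mem_unitaryGroup_iff'.1 u.2)) z

/-- The unitary operator `W_u` on `F_{p,q,n}`:
`(W_u ψ)(z_1, …, z_p, z'_1, …, z'_q) = ψ(u z_1, …, u z_p, ū z'_1, …, ū z'_q)`. -/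
def W (p q : ℕ) {n : ℕ} (u : Matrix.unitaryGroup (Fin n) ℂ) : Fock p q n ≃ₗᵢ[ℂ] Fock p q n :=
  compUnitary (unitaryAct p q u) (unitaryAct_norm p q u)

theorem W_apply (p q : ℕ) {n : ℕ} (u : Matrix.unitaryGroup (Fin n) ℂ) (ψ : Fock p q n)
    (z : Modes p q n → ℂ) :
    W p q u ψ z = ψ (Sum.elim
      (fun a => (u : Matrix (Fin n) (Fin n) ℂ).mulVec (fun l => z (Sum.inl (l, a.2))) a.1)
      (fun b => (conjMat u).mulVec (fun l => z (Sum.inr (l, b.2))) b.1)) := rfl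

/-- The symmetric subspace `F_{p,q,n}^{U(n)}`. -/
def symmetricSubspace (p q n : ℕ) : Submodule ℂ (Fock p q n) where
  carrier := {ψ | ∀ u : Matrix.unitaryGroup (Fin n) ℂ, W p q u ψ = ψ}
  zero_mem' u := map_zero (W p q u)
  add_mem' := by
    intro φ ψ hφ hψ u
    rw [map_add, hφ u, hψ u]
  smul_mem' := by
    intro c ψ hψ u
    rw [map_smul, hψ u]

/-! ### Density operators -/

/-- `T` has trace `t`: in every orthonormal (Hilbert) basis, `∑ ⟨b_i, T b_i⟩` converges
(unconditionally, hence absolutely) to `t`. -/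
def HasTrace {E : Type} [NormedAddCommGroup E] [InnerProductSpace ℂ E] (T : E →L[ℂ] E)
    (t : ℂ) : Prop :=
  ∀ (I : Type) (b : HilbertBasis I ℂ E), HasSum (fun i => inner ℂ (b i) (T (b i))) t

/-- A density operator: a positive semidefinite operator with unit trace. -/
def IsDensity {E : Type} [NormedAddCommGroup E] [InnerProductSpace ℂ E] (ρ : E →L[ℂ] E) : Prop :=
  ρ.IsPositive ∧ HasTrace ρ 1

/-- Invariance of an operator under the action of the unitary group by conjugation. The adjoint of
the unitary operator `W_u` is its inverse. -/
def IsInvariant {p q n : ℕ} (ρ : Fock p q n →L[ℂ] Fock p q n) : Prop :=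
  ∀ u : Matrix.unitaryGroup (Fin n) ℂ, ∀ ψ : Fock p q n, W p q u (ρ ((W p q u).symm ψ)) = ρ ψ

/-- `S` is the positive semidefinite square root of `T`. -/
def IsPositiveSqrt {E : Type} [NormedAddCommGroup E] [InnerProductSpace ℂ E]
    (S T : E →L[ℂ] E) : Prop :=
  S.IsPositive ∧ S ∘L S = T

/-- The truncation `ρ^{≤d} = Π^{≤d} ρ Π^{≤d}`, where `Π^{≤d}` is the orthogonal projection onto the
polynomials of total degree at most `d`. -/
def truncate {p q n : ℕ} (d : ℕ) (ρ : Fock p q n →L[ℂ] Fock p q n) : Fock p q n →L[ℂ] Fock p q n :=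
  (degreeLE (Modes p q n) d).starProjection ∘L ρ ∘L (degreeLE (Modes p q n) d).starProjection

/-! ### The factorization `F_{p+q,p+q,n} = F_{p,q,n} ⊗ F_{q,p,n}` -/

/-- The modes of the system among those of `F_{p+q,p+q,n}`:
`z_{k,1}, …, z_{k,p}` and `z'_{k,1}, …, z'_{k,q}`. -/
def sysMode {p q n : ℕ} : Modes p q n → Modes (p + q) (p + q) n :=
  Sum.map (Prod.map id (Fin.castAdd q)) (Prod.map id (Fin.castLE (Nat.le_add_left q p)))

/-- The modes of the reference system among those of `F_{p+q,p+q,n}`: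
`z_{k,p+1}, …, z_{k,p+q}` and `z'_{k,q+1}, …, z'_{k,q+p}`. -/
def refMode {p q n : ℕ} : Modes q p n → Modes (p + q) (p + q) n :=
  Sum.map (Prod.map id (Fin.natAdd p)) (Prod.map id (fun i : Fin p => Fin.addNat i q))

theorem bijective_modes (p q n : ℕ) :
    Function.Bijective (Sum.elim (sysMode (p := p) (q := q) (n := n)) refMode) := by
  rw [Fintype.bijective_iff_surjective_and_card]
  constructor
  · rintro (⟨k, i⟩ | ⟨k, j⟩)
    · rcases lt_or_ge i.1 p with h | h
      · exact ⟨Sum.inl (Sum.inl (k, ⟨i, h⟩)), rfl⟩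
      · refine ⟨Sum.inr (Sum.inl (k, ⟨i - p, by omega⟩)), ?_⟩
        simp only [Sum.elim_inr, refMode, Sum.map_inl, Prod.map, id]
        congr 2
        ext
        simp only [Fin.val_natAdd]
        omega
    · rcases lt_or_ge j.1 q with h | h
      · exact ⟨Sum.inl (Sum.inr (k, ⟨j, h⟩)), rfl⟩
      · refine ⟨Sum.inr (Sum.inr (k, ⟨j - q, by omega⟩)), ?_⟩
        simp only [Sum.elim_inr, refMode, Sum.map_inr, Prod.map, id]
        congr 2
        ext
        simp only [Fin.val_addNat]
        omega
  · simp only [Fintype.card_sum, Fintype.card_prod, Fintype.card_fin]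
    ring

theorem isState_tmul {p q n : ℕ} {f : (Modes p q n → ℂ) → ℂ} {g : (Modes q p n → ℂ) → ℂ}
    (hf : IsState f) (hg : IsState g) :
    IsState (fun z : Modes (p + q) (p + q) n → ℂ => f (z ∘ sysMode) * g (z ∘ refMode)) := by
  have hd1 : Differentiable ℂ fun z : Modes (p + q) (p + q) n → ℂ =>
      (z ∘ sysMode : Modes p q n → ℂ) := by
    rw [differentiable_pi]; intro i; simp only [Function.comp]; fun_prop
  have hd2 : Differentiable ℂ fun z : Modes (p + q) (p + q) n → ℂ =>
      (z ∘ refMode : Modes q p n → ℂ) := by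
    rw [differentiable_pi]; intro i; simp only [Function.comp]; fun_prop
  refine ⟨(hf.differentiable.comp hd1).mul (hg.differentiable.comp hd2), ?_⟩
  let e : Modes p q n ⊕ Modes q p n ≃ Modes (p + q) (p + q) n :=
    Equiv.ofBijective _ (bijective_modes p q n)
  have hmp1 := (measurePreserving_piCongrLeft
    (fun _ : Modes (p + q) (p + q) n => (volume : Measure ℂ)) e).symm
  have hmp2 := measurePreserving_sumPiEquivProdPi
    (fun _ : Modes p q n ⊕ Modes q p n => (volume : Measure ℂ))
  have hmp := hmp2.comp hmp1
  have hint := hmp.integrable_comp_of_integrable (hf.integrable.mul_prod hg.integrable)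
  refine hint.congr (.of_forall fun z => ?_)
  have hw : weight z = weight (z ∘ sysMode : Modes p q n → ℂ) *
      weight (z ∘ refMode : Modes q p n → ℂ) := by
    simp only [weight_eq_prod]
    rw [← e.prod_comp, Fintype.prod_sum_type]
    rfl
  have h1 : ((MeasurableEquiv.sumPiEquivProdPi fun _ : Modes p q n ⊕ Modes q p n => ℂ)
      ((MeasurableEquiv.piCongrLeft (fun _ : Modes (p + q) (p + q) n => ℂ) e).symm z)) =
      ((z ∘ sysMode : Modes p q n → ℂ), (z ∘ refMode : Modes q p n → ℂ)) := rfl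
  simp only [Function.comp_def] at h1 hw ⊢
  rw [h1, hw, norm_mul]
  ring

/-- The simple tensor `f ⊗ g` of a system state and a reference state: the function
`(z, z') ↦ f(z_1, …, z_p, z'_1, …, z'_q) g(z_{p+1}, …, z_{p+q}, z'_{q+1}, …, z'_{q+p})`. -/
def tmul {p q n : ℕ} (f : Fock p q n) (g : Fock q p n) : Fock (p + q) (p + q) n :=
  mkState (fun z => f (z ∘ sysMode) * g (z ∘ refMode))
    (isState_tmul (isState_coe f) (isState_coe g))

theorem tmul_apply {p q n : ℕ} (f : Fock p q n) (g : Fock q p n)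
    (z : Modes (p + q) (p + q) n → ℂ) :
    tmul f g z = f (z ∘ sysMode) * g (z ∘ refMode) := rfl

/-- `T` is the bounded operator `A ⊗ 1` on `F_{p,q,n} ⊗ F_{q,p,n}`. -/
def IsTensorOne {p q n : ℕ} (A : Fock p q n →L[ℂ] Fock p q n)
    (T : Fock (p + q) (p + q) n →L[ℂ] Fock (p + q) (p + q) n) : Prop :=
  ∀ (f : Fock p q n) (g : Fock q p n), T (tmul f g) = tmul (A f) g

/-- `ρ` is the partial trace of `R` over the reference system:
`⟨f, ρ g⟩ = ∑_i ⟨f ⊗ b_i, R (g ⊗ b_i)⟩` in every orthonormal (Hilbert) basis `b` of `F_{q,p,n}`. -/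
def IsPartialTrace {p q n : ℕ} (R : Fock (p + q) (p + q) n →L[ℂ] Fock (p + q) (p + q) n)
    (ρ : Fock p q n →L[ℂ] Fock p q n) : Prop :=
  ∀ (I : Type) (b : HilbertBasis I ℂ (Fock q p n)) (f g : Fock p q n),
    HasSum (fun i => inner ℂ (tmul f (b i)) (R (tmul g (b i)))) (inner ℂ f (ρ g))

/-- `ψ` is a purification of `ρ`: the partial trace of `|ψ⟩⟨ψ|` over the reference system
is `ρ`. -/
def IsPurification {p q n : ℕ} (ψ : Fock (p + q) (p + q) n)
    (ρ : Fock p q n →L[ℂ] Fock p q n) : Prop :=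
  IsPartialTrace (InnerProductSpace.rankOne ℂ ψ ψ) ρ

/-- The polynomial `Z_{i,j} = ∑_k z_{k,i} z'_{k,j}`. -/
def Zvar {p q n : ℕ} (i : Fin p) (j : Fin q) : MvPolynomial (Modes p q n) ℂ :=
  ∑ k : Fin n, MvPolynomial.X (Sum.inl (k, i)) * MvPolynomial.X (Sum.inr (k, j))

/-- The truncated, non-normalized maximally entangled state
`∑_{m ≤ d} (Z_{1,q+1} + ⋯ + Z_{p,q+p} + Z_{p+1,1} + ⋯ + Z_{p+q,q})^m / m!`. -/
def maxEntangled (p q n d : ℕ) : Fock (p + q) (p + q) n :=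
  polyState _ (∑ m ∈ Finset.range (d + 1), MvPolynomial.C ((m.factorial : ℂ)⁻¹) *
    (∑ i : Fin p, Zvar (Fin.castAdd q i) (Fin.addNat i q) +
      ∑ j : Fin q, Zvar (Fin.natAdd p j) (Fin.castLE (Nat.le_add_left q p) j)) ^ m)

end SegalBargmann

end

noncomputable section

namespace SegalBargmann

/-! ### Orthogonality of monomials -/

theorem integral_norm_pow_mul_gaussian (a : ℕ) :
    ∫ z : ℂ, ‖z‖ ^ (2 * a) * (Real.pi⁻¹ * Real.exp (-‖z‖ ^ 2)) = (a.factorial : ℝ) := by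
  have h := Complex.integral_rpow_mul_exp_neg_rpow (p := 2) (q := (2 * a : ℕ)) (by norm_num)
    (by have : (0 : ℝ) ≤ (2 * a : ℕ) := Nat.cast_nonneg _
        linarith)
  simp only [Real.rpow_natCast, Real.rpow_two] at h
  have h2 : (((2 * a : ℕ) : ℝ) + 2) / 2 = a + 1 := by push_cast; ring
  rw [h2, Real.Gamma_nat_eq_factorial] at h
  calc _ = ∫ z : ℂ, Real.pi⁻¹ * (‖z‖ ^ (2 * a) * Real.exp (-‖z‖ ^ 2)) :=
        integral_congr_ae (.of_forall fun z => by ring)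
    _ = _ := by
        rw [integral_const_mul, h]
        have := Real.pi_ne_zero
        field_simp

theorem integral_conj_pow_mul_pow (a b : ℕ) :
    ∫ z : ℂ, (starRingEnd ℂ) z ^ a * z ^ b * ((Real.pi⁻¹ * Real.exp (-‖z‖ ^ 2) : ℝ) : ℂ) =
      if a = b then (a.factorial : ℂ) else 0 := by
  split_ifs with h
  · subst h
    have h : (fun z : ℂ => (starRingEnd ℂ) z ^ a * z ^ a *
        ((Real.pi⁻¹ * Real.exp (-‖z‖ ^ 2) : ℝ) : ℂ)) =
        fun z => ((‖z‖ ^ (2 * a) * (Real.pi⁻¹ * Real.exp (-‖z‖ ^ 2)) : ℝ) : ℂ) := by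
      funext z
      rw [← mul_pow, Complex.conj_mul', ← pow_mul]
      push_cast
      rfl
    rw [h, integral_complex_ofReal, integral_norm_pow_mul_gaussian, Complex.ofReal_natCast]
  · set t : ℝ := Real.pi / ((b : ℝ) - a) with ht
    have hba : (b : ℝ) - a ≠ 0 := by
      rw [sub_ne_zero]; exact_mod_cast Ne.symm h
    have hmp := (rotation (Circle.exp t)).measurePreserving
    have hI := hmp.integral_comp (rotation (Circle.exp t)).toHomeomorph.measurableEmbedding
      (fun z : ℂ => (starRingEnd ℂ) z ^ a * z ^ b *
        ((Real.pi⁻¹ * Real.exp (-‖z‖ ^ 2) : ℝ) : ℂ))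
    set I := ∫ z : ℂ, (starRingEnd ℂ) z ^ a * z ^ b *
      ((Real.pi⁻¹ * Real.exp (-‖z‖ ^ 2) : ℝ) : ℂ)
    have hc : (starRingEnd ℂ) (Circle.exp t : ℂ) ^ a * (Circle.exp t : ℂ) ^ b = -1 := by
      rw [Circle.coe_exp, ← Complex.exp_conj, ← Complex.exp_nat_mul, ← Complex.exp_nat_mul,
        ← Complex.exp_add, ← Complex.exp_pi_mul_I]
      congr 1
      simp only [map_mul, Complex.conj_ofReal, Complex.conj_I]
      have : (t : ℂ) * ((b : ℂ) - a) = Real.pi := by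
        rw [ht]; push_cast
        exact div_mul_cancel₀ _ (by exact_mod_cast hba)
      linear_combination Complex.I * this
    have h2 : -I = I := by
      rw [← neg_one_mul, ← hc, ← integral_const_mul]
      refine Eq.trans (integral_congr_ae (.of_forall fun z => ?_)) hI
      simp only [rotation_apply, map_mul, mul_pow, norm_mul, Circle.norm_coe, one_mul]
      ring
    exact self_eq_neg.1 h2.symm

section Monomials

variable {ι : Type} [Fintype ι]

/-- The monomial `∏ z_i ^ α_i` in the Segal-Bargmann space. -/
def monoState (α : ι → ℕ) : SBSpace ι :=
  polyState ι (∏ i, MvPolynomial.X i ^ α i)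

theorem polyState_apply (P : MvPolynomial ι ℂ) (z : ι → ℂ) :
    polyState ι P z = MvPolynomial.eval z P := rfl

theorem monoState_apply (α : ι → ℕ) (z : ι → ℂ) : monoState α z = ∏ i, z i ^ α i := by
  simp [monoState, polyState_apply]

/-- The factorial `∏ α_i!` of a multi-index. -/
def multiFactorial (α : ι → ℕ) : ℕ := ∏ i, (α i).factorial

theorem multiFactorial_pos (α : ι → ℕ) : 0 < multiFactorial α :=
  Finset.prod_pos fun _ _ => Nat.factorial_pos _

theorem inner_monoState (α β : ι → ℕ) :
    inner ℂ (monoState α) (monoState β) = if α = β then (multiFactorial α : ℂ) else 0 := by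
  have h : ∀ z : ι → ℂ, (starRingEnd ℂ) (monoState α z) * monoState β z * (weight z : ℂ) =
      ∏ i, ((starRingEnd ℂ) (z i) ^ α i * z i ^ β i *
        ((Real.pi⁻¹ * Real.exp (-‖z i‖ ^ 2) : ℝ) : ℂ)) := by
    intro z
    rw [monoState_apply, monoState_apply, weight_eq_prod, map_prod, Complex.ofReal_prod,
      ← Finset.prod_mul_distrib, ← Finset.prod_mul_distrib]
    simp only [map_pow]
  rw [sb_inner_def]
  simp only [h]
  rw [integral_fintype_prod_volume_eq_prod (𝕜 := ℂ) (fun i (x : ℂ) =>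
    (starRingEnd ℂ) x ^ α i * x ^ β i * ((Real.pi⁻¹ * Real.exp (-‖x‖ ^ 2) : ℝ) : ℂ))]
  simp only [integral_conj_pow_mul_pow]
  split_ifs with hαβ
  · subst hαβ
    simp [multiFactorial]
  · obtain ⟨i, hi⟩ := Function.ne_iff.1 hαβ
    exact Finset.prod_eq_zero (Finset.mem_univ i) (if_neg hi)

/-- The normalized monomial `∏ z_i ^ α_i / √(α_i!)`. -/
def basisState (α : ι → ℕ) : SBSpace ι :=
  ((Real.sqrt (multiFactorial α))⁻¹ : ℂ) • monoState α

theorem sqrt_multiFactorial_ne_zero (α : ι → ℕ) :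
    ((Real.sqrt (multiFactorial α) : ℝ) : ℂ) ≠ 0 := by
  have := multiFactorial_pos α
  rw [Complex.ofReal_ne_zero]
  positivity

theorem sqrt_multiFactorial_mul_self (α : ι → ℕ) :
    ((Real.sqrt (multiFactorial α) : ℝ) : ℂ) * ((Real.sqrt (multiFactorial α) : ℝ) : ℂ) =
      multiFactorial α := by
  rw [← Complex.ofReal_mul, Real.mul_self_sqrt (by positivity), Complex.ofReal_natCast]

theorem orthonormal_basisState : Orthonormal ℂ (basisState : (ι → ℕ) → SBSpace ι) := by
  rw [orthonormal_iff_ite]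
  intro α β
  simp only [basisState, inner_smul_left, inner_smul_right, inner_monoState, map_inv₀,
    Complex.conj_ofReal]
  split_ifs with h
  · subst h
    rw [← sqrt_multiFactorial_mul_self]
    have := sqrt_multiFactorial_ne_zero α
    field_simp
  · simp

theorem monoState_eq_smul (α : ι → ℕ) :
    monoState α = ((Real.sqrt (multiFactorial α) : ℝ) : ℂ) • basisState α := by
  rw [basisState, smul_smul, mul_inv_cancel₀ (sqrt_multiFactorial_ne_zero α), one_smul]

theorem monomial_eq_prod_X (s : ι →₀ ℕ) (c : ℂ) :
    MvPolynomial.monomial s c = c • ∏ i, MvPolynomial.X i ^ s i := by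
  rw [MvPolynomial.monomial_eq, MvPolynomial.smul_eq_C_mul]
  congr 1
  exact Finsupp.prod_fintype _ _ fun i => pow_zero _

theorem polyState_mem_of_forall_monoState {V : Submodule ℂ (SBSpace ι)} (P : MvPolynomial ι ℂ)
    (h : ∀ s ∈ P.support, monoState (s : ι → ℕ) ∈ V) : polyState ι P ∈ V := by
  rw [P.as_sum, map_sum]
  refine Submodule.sum_mem _ fun s hs => ?_
  rw [monomial_eq_prod_X, map_smul]
  exact V.smul_mem _ (h s hs)

theorem polyState_mem_span (P : MvPolynomial ι ℂ) :
    polyState ι P ∈ Submodule.span ℂ (Set.range (basisState : (ι → ℕ) → SBSpace ι)) :=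
  polyState_mem_of_forall_monoState P fun s _ => by
    rw [monoState_eq_smul]
    exact Submodule.smul_mem _ _ (Submodule.subset_span ⟨_, rfl⟩)

end Monomials

/-! ### The reproducing kernel -/

section Kernel

variable {ι : Type} [Fintype ι]

theorem integrable_exp_mul_gaussian (R : ℝ) :
    Integrable (fun z : ℂ => Real.exp (R * ‖z‖) * (Real.pi⁻¹ * Real.exp (-‖z‖ ^ 2))) := by
  have h := (GaussianFourier.integrable_cexp_neg_mul_sq_norm_add (V := ℂ) (b := 1 / 2)
    (by norm_num) 0 0).norm.const_mul (Real.exp (R ^ 2 / 2) * Real.pi⁻¹)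
  refine h.mono' (by apply Continuous.aestronglyMeasurable; fun_prop) (.of_forall fun z => ?_)
  have hpi : 0 < Real.pi⁻¹ := by positivity
  rw [Real.norm_of_nonneg (by positivity), Complex.norm_exp]
  have h2 : (-(1 / 2 : ℂ) * (‖z‖ : ℂ) ^ 2 + 0 * ((inner ℝ (0 : ℂ) z : ℝ) : ℂ)).re =
      -(‖z‖ ^ 2 / 2) := by
    have : (-(1 / 2 : ℂ) * (‖z‖ : ℂ) ^ 2 + 0 * ((inner ℝ (0 : ℂ) z : ℝ) : ℂ)) =
        ((-(‖z‖ ^ 2 / 2) : ℝ) : ℂ) := by push_cast; ring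
    rw [this, Complex.ofReal_re]
  rw [h2, mul_comm Real.pi⁻¹, ← mul_assoc, ← Real.exp_add, mul_right_comm, ← Real.exp_add]
  refine mul_le_mul_of_nonneg_right (Real.exp_le_exp.2 ?_) hpi.le
  nlinarith [sq_nonneg (R - ‖z‖)]

theorem integrable_exp_mul_weight (R : ℝ) :
    Integrable (fun z : ι → ℂ => Real.exp (R * ∑ i, ‖z i‖) * weight z) := by
  refine (Integrable.fintype_prod (μ := fun _ : ι => (volume : Measure ℂ))
    (fun _ => integrable_exp_mul_gaussian R)).congr (.of_forall fun z => ?_)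
  simp only [weight_eq_prod]
  rw [Finset.mul_sum, Real.exp_sum, ← Finset.prod_mul_distrib]

theorem integral_weight : ∫ z : ι → ℂ, (weight z : ℂ) = 1 := by
  have h := inner_monoState (0 : ι → ℕ) 0
  rw [sb_inner_def] at h
  simpa [monoState_apply, multiFactorial] using h

/-- Rotation of all variables by a common phase. -/
theorem integral_comp_phase (φ : (ι → ℂ) → ℂ) {c : ℂ} (hc : ‖c‖ = 1) :
    ∫ z, φ (c • z) * (weight z : ℂ) = ∫ z, φ z * (weight z : ℂ) := by
  let L : (ι → ℂ) ≃ₗ[ℂ] (ι → ℂ) := LinearEquiv.smulOfNeZero ℂ _ c (norm_ne_zero_iff.1 (by rw [hc]; exact one_ne_zero))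
  have hL : ∀ z, ∑ i, ‖L z i‖ ^ 2 = ∑ i, ‖z i‖ ^ 2 := fun z => by
    simp [L, hc]
  have hmp := measurePreserving_of_norm L hL
  have hemb : MeasurableEmbedding (L : (ι → ℂ) → (ι → ℂ)) :=
    (LinearEquiv.toContinuousLinearEquiv L).toHomeomorph.measurableEmbedding
  rw [← hmp.integral_comp hemb fun z => φ z * (weight z : ℂ)]
  refine integral_congr_ae (.of_forall fun z => ?_)
  have hw : weight (L z) = weight z := by simp only [weight, hL]
  simp only [hw]
  rfl

theorem integral_norm_comp_phase (φ : (ι → ℂ) → ℂ) {c : ℂ} (hc : ‖c‖ = 1) :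
    ∫ z, ‖φ (c • z) * (weight z : ℂ)‖ = ∫ z, ‖φ z * (weight z : ℂ)‖ := by
  have h := integral_comp_phase (fun z => (‖φ z‖ : ℂ)) hc
  have h2 : ∀ ψ : (ι → ℂ) → ℂ, ∫ z, (‖ψ z‖ : ℂ) * (weight z : ℂ) =
      ((∫ z, ‖ψ z * (weight z : ℂ)‖ : ℝ) : ℂ) := by
    intro ψ
    rw [← integral_complex_ofReal]
    refine integral_congr_ae (.of_forall fun z => ?_)
    simp [abs_of_pos (weight_pos z)]
  rw [h2 fun z => φ (c • z), h2] at h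
  exact_mod_cast h

theorem integrable_comp_phase {φ : (ι → ℂ) → ℂ}
    (hi : Integrable fun z => φ z * (weight z : ℂ)) {c : ℂ} (hc : ‖c‖ = 1) :
    Integrable fun z => φ (c • z) * (weight z : ℂ) := by
  let L : (ι → ℂ) ≃ₗ[ℂ] (ι → ℂ) := LinearEquiv.smulOfNeZero ℂ _ c (norm_ne_zero_iff.1 (by rw [hc]; exact one_ne_zero))
  have hL : ∀ z, ∑ i, ‖L z i‖ ^ 2 = ∑ i, ‖z i‖ ^ 2 := fun z => by
    simp [L, hc]
  refine ((measurePreserving_of_norm L hL).integrable_comp_of_integrable hi).congr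
    (.of_forall fun z => ?_)
  have hw : weight (L z) = weight z := by simp only [weight, hL]
  simp only [Function.comp, hw]
  rfl

theorem integral_phase_eq {φ : (ι → ℂ) → ℂ} (hd : Differentiable ℂ φ) (w : ι → ℂ) :
    ∫ θ in (0)..(2 * Real.pi), φ (Complex.exp (θ * Complex.I) • w) = (2 * Real.pi : ℝ) * φ 0 := by
  have hd' : Differentiable ℂ fun t : ℂ => φ (t • w) :=
    hd.comp (differentiable_id.smul_const w)
  have h := (hd'.diffContOnCl (s := Metric.ball 0 |1|)).circleAverage
  rw [Real.circleAverage] at h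
  simp only [circleMap_zero, Complex.ofReal_one, one_mul, zero_smul] at h
  rw [← h]
  have hpi : (2 * Real.pi : ℝ) ≠ 0 := by positivity
  rw [Complex.real_smul, ← mul_assoc, ← Complex.ofReal_mul, mul_inv_cancel₀ hpi,
    Complex.ofReal_one, one_mul]

/-- The mean value property for the Gaussian measure. -/
theorem integral_mul_weight_eq {φ : (ι → ℂ) → ℂ} (hd : Differentiable ℂ φ)
    (hi : Integrable fun z => φ z * (weight z : ℂ)) : ∫ z, φ z * (weight z : ℂ) = φ 0 := by
  have hw := continuous_weight (ι := ι)
  have hφ := hd.continuous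
  have hcirc : Continuous fun θ : ℝ => Complex.exp (θ * Complex.I) := by fun_prop
  set μ : Measure ℝ := volume.restrict (Set.Ioc 0 (2 * Real.pi))
  have hint : Integrable (Function.uncurry fun (θ : ℝ) (z : ι → ℂ) =>
      φ (Complex.exp (θ * Complex.I) • z) * (weight z : ℂ)) (μ.prod volume) := by
    rw [integrable_prod_iff (by
      apply Continuous.aestronglyMeasurable; unfold Function.uncurry; fun_prop)]
    refine ⟨.of_forall fun θ => integrable_comp_phase hi
      (Complex.norm_exp_ofReal_mul_I θ), ?_⟩
    simp only [Function.uncurry, integral_norm_comp_phase φ (Complex.norm_exp_ofReal_mul_I _)]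
    exact integrable_const _
  have hswap := integral_integral_swap hint
  simp only [integral_comp_phase φ (Complex.norm_exp_ofReal_mul_I _), integral_mul_const] at hswap
  have h2 : ∀ z : ι → ℂ, ∫ θ, φ (Complex.exp (θ * Complex.I) • z) ∂μ = (2 * Real.pi : ℝ) * φ 0 := by
    intro z
    rw [← integral_phase_eq hd z, intervalIntegral.integral_of_le (by positivity)]
  simp only [h2] at hswap
  rw [integral_const_mul, integral_weight, mul_one, integral_const] at hswap
  have hμ : μ.real Set.univ = 2 * Real.pi := by
    simp [μ, Measure.real, Real.pi_pos.le]
  rw [hμ, Complex.real_smul] at hswap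
  exact mul_left_cancel₀ (by
    have := Real.pi_pos
    rw [Complex.ofReal_ne_zero]; positivity) hswap

/-- The linear form `z ↦ ∑ z_i \bar w_i`. -/
def pairing (w : ι → ℂ) : (ι → ℂ) →L[ℂ] ℂ :=
  ∑ i, (starRingEnd ℂ) (w i) • ContinuousLinearMap.proj (R := ℂ) (φ := fun _ : ι => ℂ) i

theorem pairing_apply (w z : ι → ℂ) : pairing w z = ∑ i, (starRingEnd ℂ) (w i) * z i := by
  simp [pairing]

theorem continuous_pairing : Continuous (pairing : (ι → ℂ) → (ι → ℂ) →L[ℂ] ℂ) := by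
  unfold pairing
  have := Complex.continuous_conj
  fun_prop

theorem norm_pairing_apply_le (w z : ι → ℂ) : ‖pairing w z‖ ≤ ‖z‖ * ∑ i, ‖w i‖ := by
  rw [pairing_apply, Finset.mul_sum]
  refine (norm_sum_le _ _).trans (Finset.sum_le_sum fun i _ => ?_)
  rw [norm_mul, RCLike.norm_conj, mul_comm]
  exact mul_le_mul_of_nonneg_right (norm_le_pi_norm z i) (norm_nonneg _)

theorem norm_pairing_le (w : ι → ℂ) : ‖pairing w‖ ≤ Real.exp (∑ i, ‖w i‖) := by
  have h : ‖pairing w‖ ≤ ∑ i, ‖w i‖ :=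
    ContinuousLinearMap.opNorm_le_bound _ (Finset.sum_nonneg fun _ _ => norm_nonneg _) fun z => by
      rw [mul_comm]; exact norm_pairing_apply_le w z
  linarith [Real.add_one_le_exp (∑ i, ‖w i‖)]

theorem norm_exp_pairing_le (w z : ι → ℂ) :
    ‖Complex.exp (pairing w z)‖ ≤ Real.exp (‖z‖ * ∑ i, ‖w i‖) :=
  (Complex.norm_exp_le_exp_norm _).trans (Real.exp_le_exp.2 (norm_pairing_apply_le w z))

theorem sqrt_weight_mul_self (z : ι → ℂ) : √(weight z) * √(weight z) = weight z :=
  Real.mul_self_sqrt (weight_pos z).le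

theorem continuous_sqrt_weight : Continuous fun z : ι → ℂ => √(weight z) :=
  Real.continuous_sqrt.comp continuous_weight

theorem integrable_exp_mul_sqrt_weight {G : (ι → ℂ) → ℂ} (hG : MemLp G 2 volume) (R : ℝ) :
    Integrable fun w : ι → ℂ => Real.exp (R * ∑ i, ‖w i‖) * (√(weight w) * ‖G w‖) := by
  have hG2 : Integrable fun w => ‖G w‖ ^ 2 := (memLp_two_iff_integrable_sq_norm hG.1).1 hG
  have hc := continuous_sqrt_weight (ι := ι)
  refine ((integrable_exp_mul_weight (2 * R)).add hG2).mono' ?_ (.of_forall fun w => ?_)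
  · refine AEStronglyMeasurable.mul (by apply Continuous.aestronglyMeasurable; fun_prop)
      (AEStronglyMeasurable.mul hc.aestronglyMeasurable hG.1.norm)
  · rw [Real.norm_of_nonneg (by positivity)]
    simp only [Pi.add_apply]
    have h1 : Real.exp (2 * R * ∑ i, ‖w i‖) = Real.exp (R * ∑ i, ‖w i‖) ^ 2 := by
      rw [← Real.exp_nat_mul]; congr 1; push_cast; ring
    have h2 := sqrt_weight_mul_self w
    rw [h1]
    nlinarith [congrArg (Real.exp (R * ∑ i, ‖w i‖) ^ 2 * ·) h2, sq_nonneg (Real.exp (R * ∑ i, ‖w i‖) * √(weight w) - ‖G w‖),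
      sq_nonneg (Real.exp (R * ∑ i, ‖w i‖) * √(weight w)), sq_nonneg ‖G w‖]

theorem memLp_mul_sqrt_weight {ψ : (ι → ℂ) → ℂ} (hc : Continuous ψ)
    (hi : Integrable fun z => ‖ψ z‖ ^ 2 * weight z) :
    MemLp (fun z => ψ z * (√(weight z) : ℂ)) 2 volume := by
  have hw := continuous_sqrt_weight (ι := ι)
  rw [memLp_two_iff_integrable_sq_norm (by apply Continuous.aestronglyMeasurable; fun_prop)]
  refine hi.congr (.of_forall fun z => ?_)
  simp only [norm_mul, mul_pow, Complex.norm_real, Real.norm_eq_abs, sq_abs]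
  rw [Real.sq_sqrt (weight_pos z).le]

theorem integrable_exp_pairing_mul {G : (ι → ℂ) → ℂ} (hG : MemLp G 2 volume) (z : ι → ℂ) :
    Integrable fun w => Complex.exp (pairing w z) * ((√(weight w) : ℂ) * G w) := by
  have hc := continuous_sqrt_weight (ι := ι)
  have hp := continuous_pairing (ι := ι)
  refine (integrable_exp_mul_sqrt_weight hG ‖z‖).mono' ?_ (.of_forall fun w => ?_)
  · exact AEStronglyMeasurable.mul (by apply Continuous.aestronglyMeasurable; fun_prop)
      (AEStronglyMeasurable.mul (by apply Continuous.aestronglyMeasurable; fun_prop) hG.1)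
  · rw [norm_mul, norm_mul, Complex.norm_real, Real.norm_of_nonneg (Real.sqrt_nonneg _)]
    gcongr
    exact norm_exp_pairing_le w z

/-- The Bargmann projection of a square-integrable function is entire. -/
theorem differentiable_integral_exp_pairing {G : (ι → ℂ) → ℂ} (hG : MemLp G 2 volume) :
    Differentiable ℂ fun z => ∫ w, Complex.exp (pairing w z) * ((√(weight w) : ℂ) * G w) := by
  intro z₀
  have hc := continuous_sqrt_weight (ι := ι)
  have hp := continuous_pairing (ι := ι)
  have hG' : AEStronglyMeasurable (fun w => (√(weight w) : ℂ) * G w) volume :=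
    AEStronglyMeasurable.mul (by apply Continuous.aestronglyMeasurable; fun_prop) hG.1
  refine (hasFDerivAt_integral_of_dominated_of_fderiv_le (𝕜 := ℂ)
    (F' := fun z w => ((√(weight w) : ℂ) * G w) • (Complex.exp (pairing w z) • pairing w))
    (bound := fun w => Real.exp ((‖z₀‖ + 2) * ∑ i, ‖w i‖) * (√(weight w) * ‖G w‖))
    (Metric.ball_mem_nhds z₀ one_pos)
    (.of_forall fun z => (integrable_exp_pairing_mul hG z).1) (integrable_exp_pairing_mul hG z₀)
    ?_ (.of_forall fun w z hz => ?_) (integrable_exp_mul_sqrt_weight hG _)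
    (.of_forall fun w z _ => ?_)).differentiableAt
  · exact hG'.smul (by apply Continuous.aestronglyMeasurable; fun_prop)
  · rw [norm_smul, norm_smul, norm_mul, Complex.norm_real,
      Real.norm_of_nonneg (Real.sqrt_nonneg _), mul_comm]
    refine mul_le_mul_of_nonneg_right ?_ (by positivity)
    refine (mul_le_mul (norm_exp_pairing_le w z) (norm_pairing_le w) (norm_nonneg _)
      (Real.exp_nonneg _)).trans ?_
    rw [← Real.exp_add]
    refine Real.exp_le_exp.2 ?_
    have h1 : ‖z‖ ≤ ‖z₀‖ + 1 := by
      have := norm_sub_norm_le z z₀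
      have h2 : ‖z - z₀‖ < 1 := by simpa [dist_eq_norm] using hz
      linarith
    have h3 : (0 : ℝ) ≤ ∑ i, ‖w i‖ := Finset.sum_nonneg fun _ _ => norm_nonneg _
    nlinarith
  · have h := ((pairing w).hasFDerivAt (x := z)).cexp
    exact h.mul_const _

/-- The reproducing property of the kernel `exp (∑ z_i \bar w_i)`. -/
theorem integral_exp_pairing_mul {ψ : (ι → ℂ) → ℂ} (hψ : IsState ψ) (z : ι → ℂ) :
    ∫ w, Complex.exp (pairing w z) * ((√(weight w) : ℂ) * (ψ w * (√(weight w) : ℂ))) = ψ z := by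
  have hL := memLp_mul_sqrt_weight hψ.differentiable.continuous hψ.integrable
  have hint := integrable_exp_pairing_mul hL z
  have hint' := hint.comp_add_right z
  rw [← integral_add_right_eq_self _ z]
  have key : ∀ v : ι → ℂ, Complex.exp (pairing (v + z) z) * ((√(weight (v + z)) : ℂ) *
      (ψ (v + z) * (√(weight (v + z)) : ℂ))) =
      (Complex.exp (-pairing z v) * ψ (v + z)) * (weight v : ℂ) := by
    intro v
    have h1 : (√(weight (v + z)) : ℂ) * (√(weight (v + z)) : ℂ) = (weight (v + z) : ℂ) := by
      rw [← Complex.ofReal_mul, sqrt_weight_mul_self]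
    have h2 : Complex.exp (pairing (v + z) z) * (weight (v + z) : ℂ) =
        Complex.exp (-pairing z v) * (weight v : ℂ) := by
      simp only [weight, Complex.ofReal_mul, Complex.ofReal_exp]
      rw [mul_left_comm, ← Complex.exp_add, mul_left_comm, ← Complex.exp_add]
      congr 2
      push_cast
      simp only [pairing_apply, ← Finset.sum_neg_distrib, ← Finset.sum_add_distrib,
        ← Complex.conj_mul', Pi.add_apply, map_add]
      refine Finset.sum_congr rfl fun i _ => ?_
      ring
    linear_combination (Complex.exp (pairing (v + z) z) * ψ (v + z)) * h1 + ψ (v + z) * h2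
  simp only [key] at hint' ⊢
  have hd := hψ.differentiable
  rw [integral_mul_weight_eq (by fun_prop) hint']
  simp

end Kernel

/-! ### Completeness and the monomial basis -/

section Basis

variable {ι : Type} [Fintype ι]

theorem ofReal_sqrt_weight_mul_self (z : ι → ℂ) :
    (√(weight z) : ℂ) * (√(weight z) : ℂ) = (weight z : ℂ) := by
  rw [← Complex.ofReal_mul, sqrt_weight_mul_self]

theorem memLp_coe_mul_sqrt_weight (ψ : SBSpace ι) :
    MemLp (fun z => ψ z * (√(weight z) : ℂ)) 2 volume :=
  memLp_mul_sqrt_weight (isState_coe ψ).differentiable.continuous (isState_coe ψ).integrable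

/-- The isometric embedding `ψ ↦ ψ √weight` into `L²(ℂ^ι)`. -/
def toL2 (ι : Type) [Fintype ι] : SBSpace ι →ₗᵢ[ℂ] Lp ℂ 2 (volume : Measure (ι → ℂ)) :=
  LinearMap.isometryOfInner
    { toFun := fun ψ => (memLp_coe_mul_sqrt_weight ψ).toLp _
      map_add' := fun φ ψ => by
        rw [← MemLp.toLp_add]
        congr 1
        funext z
        exact add_mul _ _ _
      map_smul' := fun c ψ => by
        rw [RingHom.id_apply, ← MemLp.toLp_const_smul]
        congr 1
        funext z
        exact mul_assoc _ _ _ }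
    (by
      intro φ ψ
      simp only [LinearMap.coe_mk, AddHom.coe_mk]
      rw [L2.inner_def, sb_inner_def]
      refine integral_congr_ae ?_
      filter_upwards [(memLp_coe_mul_sqrt_weight φ).coeFn_toLp,
        (memLp_coe_mul_sqrt_weight ψ).coeFn_toLp] with z h1 h2
      rw [h1, h2, RCLike.inner_apply, map_mul, Complex.conj_ofReal,
        ← ofReal_sqrt_weight_mul_self z]
      ring)

theorem toL2_ae (ψ : SBSpace ι) : toL2 ι ψ =ᵐ[volume] fun z => ψ z * (√(weight z) : ℂ) :=
  (memLp_coe_mul_sqrt_weight ψ).coeFn_toLp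

theorem memLp_kernel (z : ι → ℂ) :
    MemLp (fun w => (starRingEnd ℂ) (Complex.exp (pairing w z)) * (√(weight w) : ℂ)) 2
      volume := by
  have hp := continuous_pairing (ι := ι)
  have hw := continuous_weight (ι := ι)
  have hconj := Complex.continuous_conj
  refine memLp_mul_sqrt_weight (by fun_prop) ?_
  refine (integrable_exp_mul_weight (2 * ‖z‖)).mono'
    (by apply Continuous.aestronglyMeasurable; fun_prop) (.of_forall fun w => ?_)
  have h := weight_pos w
  rw [Real.norm_of_nonneg (by positivity), RCLike.norm_conj]
  refine mul_le_mul_of_nonneg_right ?_ h.le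
  refine (pow_le_pow_left₀ (norm_nonneg _) (norm_exp_pairing_le w z) 2).trans_eq ?_
  rw [← Real.exp_nat_mul]
  congr 1
  push_cast
  ring

theorem inner_kernel (z : ι → ℂ) (G : Lp ℂ 2 (volume : Measure (ι → ℂ))) :
    inner ℂ ((memLp_kernel z).toLp _) G =
      ∫ w, Complex.exp (pairing w z) * ((√(weight w) : ℂ) * G w) := by
  rw [L2.inner_def]
  refine integral_congr_ae ?_
  filter_upwards [(memLp_kernel z).coeFn_toLp] with w h
  rw [h, RCLike.inner_apply, map_mul, Complex.conj_conj, Complex.conj_ofReal]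
  ring

theorem inner_kernel_toL2 (z : ι → ℂ) (ψ : SBSpace ι) :
    inner ℂ ((memLp_kernel z).toLp _) (toL2 ι ψ) = ψ z := by
  rw [inner_kernel, ← integral_exp_pairing_mul (isState_coe ψ) z]
  refine integral_congr_ae ?_
  filter_upwards [toL2_ae ψ] with w h
  rw [h]

instance instCompleteSpaceSBSpace (ι : Type) [Fintype ι] : CompleteSpace (SBSpace ι) := by
  refine Metric.complete_of_cauchySeq_tendsto fun u hu => ?_
  obtain ⟨G, hG⟩ := cauchySeq_tendsto_of_complete ((toL2 ι).isometry.uniformContinuous.comp_cauchySeq hu)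
  set g : (ι → ℂ) → ℂ := fun z => ∫ w, Complex.exp (pairing w z) * ((√(weight w) : ℂ) * G w)
    with hg
  have hpt : ∀ z, Tendsto (fun n => u n z) atTop (𝓝 (g z)) := by
    intro z
    have h : Tendsto (fun n => inner ℂ ((memLp_kernel z).toLp _) (toL2 ι (u n))) atTop
        (𝓝 (inner ℂ ((memLp_kernel z).toLp _) G)) := tendsto_const_nhds.inner hG
    simp only [inner_kernel_toL2] at h
    rwa [inner_kernel] at h
  obtain ⟨ns, hns, hae⟩ := (tendstoInMeasure_of_tendsto_Lp hG).exists_seq_tendsto_ae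
  have hGg : G =ᵐ[volume] fun z => g z * (√(weight z) : ℂ) := by
    have h : ∀ᵐ z, ∀ k, toL2 ι (u (ns k)) z = u (ns k) z * (√(weight z) : ℂ) :=
      ae_all_iff.2 fun k => toL2_ae _
    filter_upwards [hae, h] with z h1 h2
    refine tendsto_nhds_unique h1 ?_
    simp only [Function.comp, h2]
    exact ((hpt z).comp hns.tendsto_atTop).mul_const _
  have hstate : IsState g := by
    refine ⟨differentiable_integral_exp_pairing (Lp.memLp G), ?_⟩
    have h := (memLp_two_iff_integrable_sq_norm (Lp.memLp G).1).1 (Lp.memLp G)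
    refine h.congr ?_
    filter_upwards [hGg] with z hz
    rw [hz, norm_mul, mul_pow, Complex.norm_real, Real.norm_eq_abs, sq_abs,
      Real.sq_sqrt (weight_pos z).le]
  refine ⟨mkState g hstate, ?_⟩
  have hJ : toL2 ι (mkState g hstate) = G := Lp.ext ((toL2_ae _).trans hGg.symm)
  rw [← hJ] at hG
  exact (toL2 ι).isometry.isUniformInducing.isInducing.tendsto_nhds_iff.2 hG

/-- The polynomial `w ↦ (∑ \bar z_i w_i)^m`. -/
theorem inner_linearForm_pow (z : ι → ℂ) (m : ℕ) (ψ : SBSpace ι) :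
    inner ℂ (polyState ι ((∑ i, MvPolynomial.C ((starRingEnd ℂ) (z i)) * MvPolynomial.X i) ^ m)) ψ =
      ∫ w, pairing w z ^ m * ((√(weight w) : ℂ) * (ψ w * (√(weight w) : ℂ))) := by
  rw [sb_inner_def]
  refine integral_congr_ae (.of_forall fun w => ?_)
  simp only [polyState_apply, map_pow, map_sum, map_mul, MvPolynomial.eval_C,
    MvPolynomial.eval_X, Complex.conj_conj, pairing_apply]
  rw [← ofReal_sqrt_weight_mul_self w]
  simp only [mul_comm (z _)]
  ring

theorem eq_zero_of_inner_polyState (ψ : SBSpace ι)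
    (h : ∀ P, inner ℂ (polyState ι P) ψ = 0) : ψ = 0 := by
  refine sb_ext fun z => ?_
  change ψ z = 0
  have hL := memLp_coe_mul_sqrt_weight ψ
  have hw := continuous_sqrt_weight (ι := ι)
  have hp := continuous_pairing (ι := ι)
  have hc := (isState_coe ψ).differentiable.continuous
  have hsum := hasSum_integral_of_dominated_convergence
    (F := fun (m : ℕ) (w : ι → ℂ) => (m.factorial : ℂ)⁻¹ * pairing w z ^ m *
      ((√(weight w) : ℂ) * (ψ w * (√(weight w) : ℂ))))
    (f := fun w => Complex.exp (pairing w z) * ((√(weight w) : ℂ) * (ψ w * (√(weight w) : ℂ))))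
    (μ := volume)
    (bound := fun m w => (‖z‖ * ∑ i, ‖w i‖) ^ m / m.factorial *
      (√(weight w) * ‖ψ w * (√(weight w) : ℂ)‖))
    (fun m => by apply Continuous.aestronglyMeasurable; fun_prop)
    (fun m => .of_forall fun w => by
      rw [norm_mul, norm_mul, norm_mul, norm_inv, Complex.norm_natCast, norm_pow,
        Complex.norm_real, Real.norm_of_nonneg (Real.sqrt_nonneg _), div_eq_inv_mul]
      gcongr
      exact norm_pairing_apply_le w z)
    (.of_forall fun w => (Real.summable_pow_div_factorial _).mul_right _)
    (by
      refine (integrable_exp_mul_sqrt_weight hL ‖z‖).congr (.of_forall fun w => ?_)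
      simp only [tsum_mul_right]
      rw [Real.exp_eq_exp_ℝ, NormedSpace.exp_eq_tsum_div])
    (.of_forall fun w => by
      refine HasSum.mul_right _ ?_
      have := NormedSpace.expSeries_div_hasSum_exp (𝔸 := ℂ) (pairing w z)
      rw [← Complex.exp_eq_exp_ℂ] at this
      simpa only [div_eq_inv_mul] using this)
  rw [integral_exp_pairing_mul (isState_coe ψ) z] at hsum
  refine hsum.unique ?_
  have h0 : ∀ m : ℕ, ∫ w, (m.factorial : ℂ)⁻¹ * pairing w z ^ m *
      ((√(weight w) : ℂ) * (ψ w * (√(weight w) : ℂ))) = 0 := by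
    intro m
    simp only [mul_assoc]
    rw [integral_const_mul, ← inner_linearForm_pow, h, mul_zero]
  simp only [h0]
  exact hasSum_zero

/-- The Hilbert basis of normalized monomials. -/
def monoBasis (ι : Type) [Fintype ι] : HilbertBasis (ι → ℕ) ℂ (SBSpace ι) :=
  HilbertBasis.mkOfOrthogonalEqBot (orthonormal_basisState (ι := ι)) (by
    rw [Submodule.eq_bot_iff]
    intro ψ hψ
    exact eq_zero_of_inner_polyState ψ fun P =>
      (Submodule.mem_orthogonal _ _).1 hψ _ (polyState_mem_span P))

theorem monoBasis_apply (α : ι → ℕ) : monoBasis ι α = basisState α := by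
  simp [monoBasis]

/-! ### Polynomials of bounded degree -/

/-- The multi-indices of degree at most `d`. -/
def multiLE (ι : Type) [Fintype ι] (d : ℕ) : Finset (ι → ℕ) :=
  haveI := Classical.decEq ι
  (Finset.range (d + 1)).biUnion fun m => Finset.piAntidiag Finset.univ m

theorem mem_multiLE {d : ℕ} {α : ι → ℕ} : α ∈ multiLE ι d ↔ ∑ i, α i ≤ d := by
  simp [multiLE]

theorem prod_X_mem_restrictTotalDegree {d : ℕ} {α : ι → ℕ} (h : ∑ i, α i ≤ d) :
    ∏ i, (MvPolynomial.X i : MvPolynomial ι ℂ) ^ α i ∈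
      MvPolynomial.restrictTotalDegree ι ℂ d := by
  rw [MvPolynomial.mem_restrictTotalDegree]
  refine (MvPolynomial.totalDegree_finsetProd _ _).trans (le_trans ?_ h)
  refine Finset.sum_le_sum fun i _ => (MvPolynomial.totalDegree_pow _ _).trans ?_
  simp

theorem basisState_mem_degreeLE {d : ℕ} {α : ι → ℕ} (h : α ∈ multiLE ι d) :
    basisState α ∈ degreeLE ι d :=
  Submodule.smul_mem _ _
    (Submodule.mem_map_of_mem (prod_X_mem_restrictTotalDegree (mem_multiLE.1 h)))

theorem degreeLE_le {d : ℕ} {V : Submodule ℂ (SBSpace ι)}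
    (h : ∀ α ∈ multiLE ι d, basisState α ∈ V) : degreeLE ι d ≤ V := by
  rintro _ ⟨P, hP, rfl⟩
  refine polyState_mem_of_forall_monoState P fun s hs => ?_
  rw [monoState_eq_smul]
  refine V.smul_mem _ (h _ (mem_multiLE.2 ?_))
  have h1 := MvPolynomial.le_totalDegree hs
  rw [Finsupp.sum_fintype _ _ fun _ => rfl] at h1
  exact h1.trans ((MvPolynomial.mem_restrictTotalDegree _ _ _).1 hP)

theorem basisState_mem_orthogonal {d : ℕ} {α : ι → ℕ} (h : α ∉ multiLE ι d) :
    basisState α ∈ (degreeLE ι d)ᗮ := by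
  have h1 : degreeLE ι d ≤ (ℂ ∙ basisState α)ᗮ := degreeLE_le fun β hβ => by
    rw [Submodule.mem_orthogonal_singleton_iff_inner_right]
    exact orthonormal_basisState.2 fun hαβ => h (hαβ ▸ hβ)
  rw [Submodule.mem_orthogonal']
  intro u hu
  exact Submodule.mem_orthogonal_singleton_iff_inner_right.1 (h1 hu)

theorem starProjection_basisState {d : ℕ} {α : ι → ℕ} (h : α ∈ multiLE ι d) :
    (degreeLE ι d).starProjection (basisState α) = basisState α :=
  Submodule.starProjection_eq_self_iff.2 (basisState_mem_degreeLE h)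

theorem starProjection_basisState_of_notMem {d : ℕ} {α : ι → ℕ} (h : α ∉ multiLE ι d) :
    (degreeLE ι d).starProjection (basisState α) = 0 :=
  (Submodule.starProjection_apply_eq_zero_iff _).2 (basisState_mem_orthogonal h)

theorem starProjection_eq_sum (d : ℕ) (f : SBSpace ι) :
    (degreeLE ι d).starProjection f =
      ∑ α ∈ multiLE ι d, inner ℂ (basisState α) f • basisState α := by
  classical
  have h := ((monoBasis ι).hasSum_repr f).mapL (degreeLE ι d).starProjection
  refine h.unique ?_
  have h2 := hasSum_sum_of_ne_finset_zero (L := .unconditional _) (s := multiLE ι d)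
    (f := fun α => (degreeLE ι d).starProjection ((monoBasis ι).repr f α • monoBasis ι α))
    (fun α hα => by
      rw [map_smul, monoBasis_apply, starProjection_basisState_of_notMem hα, smul_zero])
  convert h2 using 2 with α hα
  rw [map_smul, monoBasis_apply, starProjection_basisState hα, HilbertBasis.repr_apply_apply,
    monoBasis_apply]

end Basis

/-! ### Tensor products -/

section Tensor

variable {p q n : ℕ}

theorem weight_eq_mul (z : Modes (p + q) (p + q) n → ℂ) :
    weight z = weight (z ∘ sysMode : Modes p q n → ℂ) * weight (z ∘ refMode : Modes q p n → ℂ) := by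
  simp only [weight_eq_prod]
  rw [← (Equiv.ofBijective _ (bijective_modes p q n)).prod_comp, Fintype.prod_sum_type]
  rfl

theorem inner_tmul (f f' : Fock p q n) (g g' : Fock q p n) :
    inner ℂ (tmul f g) (tmul f' g') = inner ℂ f f' * inner ℂ g g' := by
  let e : Modes p q n ⊕ Modes q p n ≃ Modes (p + q) (p + q) n :=
    Equiv.ofBijective _ (bijective_modes p q n)
  have hmp1 := (measurePreserving_piCongrLeft
    (fun _ : Modes (p + q) (p + q) n => (volume : Measure ℂ)) e).symm
  have hmp2 := measurePreserving_sumPiEquivProdPi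
    (fun _ : Modes p q n ⊕ Modes q p n => (volume : Measure ℂ))
  have hmp := hmp2.comp hmp1
  have hemb := (MeasurableEquiv.measurableEmbedding
    ((MeasurableEquiv.piCongrLeft (fun _ : Modes (p + q) (p + q) n => ℂ) e).symm.trans
      (MeasurableEquiv.sumPiEquivProdPi fun _ : Modes p q n ⊕ Modes q p n => ℂ)))
  rw [sb_inner_def, sb_inner_def, sb_inner_def]
  rw [← integral_prod_mul]
  have h := hmp.integral_comp hemb
    (fun x : (Modes p q n → ℂ) × (Modes q p n → ℂ) =>
      ((starRingEnd ℂ) (f x.1) * f' x.1 * (weight x.1 : ℂ)) *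
        ((starRingEnd ℂ) (g x.2) * g' x.2 * (weight x.2 : ℂ)))
  refine Eq.trans ?_ h
  refine integral_congr_ae (.of_forall fun z => ?_)
  have h1 : ((MeasurableEquiv.sumPiEquivProdPi fun _ : Modes p q n ⊕ Modes q p n => ℂ)
      ((MeasurableEquiv.piCongrLeft (fun _ : Modes (p + q) (p + q) n => ℂ) e).symm z)) =
      ((z ∘ sysMode : Modes p q n → ℂ), (z ∘ refMode : Modes q p n → ℂ)) := rfl
  simp only [Function.comp_apply, h1, tmul_apply, weight_eq_mul z, map_mul]
  push_cast
  ring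

theorem norm_tmul (f : Fock p q n) (g : Fock q p n) : ‖tmul f g‖ = ‖f‖ * ‖g‖ := by
  have h := inner_tmul f f g g
  rw [inner_self_eq_norm_sq_to_K, inner_self_eq_norm_sq_to_K, inner_self_eq_norm_sq_to_K,
    ← mul_pow] at h
  have h2 : ‖tmul f g‖ ^ 2 = (‖f‖ * ‖g‖) ^ 2 := by exact_mod_cast h
  exact (pow_left_inj₀ (norm_nonneg _) (by positivity) two_ne_zero).1 h2

/-- Tensoring with a fixed system state, `g ↦ f ⊗ g`. -/
def tensorLeft (f : Fock p q n) : Fock q p n →L[ℂ] Fock (p + q) (p + q) n :=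
  LinearMap.mkContinuous
    { toFun := fun g => tmul f g
      map_add' := fun _ _ => sb_ext fun _ => mul_add _ _ _
      map_smul' := fun _ _ => sb_ext fun _ => mul_left_comm _ _ _ }
    ‖f‖ fun g => (norm_tmul f g).le

/-- Tensoring with a fixed reference state, `f ↦ f ⊗ g`. -/
def tensorRight (g : Fock q p n) : Fock p q n →L[ℂ] Fock (p + q) (p + q) n :=
  LinearMap.mkContinuous
    { toFun := fun f => tmul f g
      map_add' := fun _ _ => sb_ext fun _ => add_mul _ _ _
      map_smul' := fun _ _ => sb_ext fun _ => mul_assoc _ _ _ }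
    ‖g‖ fun f => by rw [mul_comm]; exact (norm_tmul f g).le

theorem tensorLeft_apply (f : Fock p q n) (g : Fock q p n) : tensorLeft f g = tmul f g := rfl

theorem tensorRight_apply (f : Fock p q n) (g : Fock q p n) : tensorRight g f = tmul f g := rfl

theorem adjoint_tensorLeft_tmul (h f : Fock p q n) (g : Fock q p n) :
    (tensorLeft h).adjoint (tmul f g) = (inner ℂ h f : ℂ) • g := by
  refine ext_inner_left ℂ fun g' => ?_
  rw [ContinuousLinearMap.adjoint_inner_right, tensorLeft_apply, inner_tmul, inner_smul_right]

/-- The operator `A Π^{≤d} ⊗ 1`. -/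
def tensorOne (d : ℕ) (A : Fock p q n →L[ℂ] Fock p q n) :
    Fock (p + q) (p + q) n →L[ℂ] Fock (p + q) (p + q) n :=
  ∑ α ∈ multiLE (Modes p q n) d,
    tensorLeft (A (basisState α)) ∘L (tensorLeft (basisState α)).adjoint

theorem tensorOne_tmul (d : ℕ) (A : Fock p q n →L[ℂ] Fock p q n) (f : Fock p q n)
    (g : Fock q p n) :
    tensorOne d A (tmul f g) = tmul (A ((degreeLE (Modes p q n) d).starProjection f)) g := by
  rw [starProjection_eq_sum, map_sum]
  change _ = tensorRight g _
  rw [map_sum, tensorOne, sum_apply]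
  refine Finset.sum_congr rfl fun α _ => ?_
  rw [ContinuousLinearMap.comp_apply, adjoint_tensorLeft_tmul, map_smul, map_smul, map_smul,
    tensorLeft_apply, tensorRight_apply]

/-- The identification of the system variables with the reference variables. -/
def swapState (α : Modes p q n → ℕ) : Fock q p n := basisState (α ∘ Sum.swap)

theorem inner_swapState (α β : Modes p q n → ℕ) :
    inner ℂ (swapState α) (swapState β) = if α = β then (1 : ℂ) else 0 := by
  classical
  have h := orthonormal_iff_ite.1 (orthonormal_basisState (ι := Modes q p n))
    (α ∘ Sum.swap) (β ∘ Sum.swap)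
  rw [swapState, swapState, h]
  refine if_congr ?_ rfl rfl
  exact (Equiv.sumComm _ _).surjective.injective_comp_right.eq_iff

theorem norm_swapState (α : Modes p q n → ℕ) : ‖swapState α‖ = 1 :=
  orthonormal_basisState.1 _

/-! ### The maximally entangled state -/

theorem maxEntangled_apply (d : ℕ) (z : Modes (p + q) (p + q) n → ℂ) :
    maxEntangled p q n d z = ∑ m ∈ Finset.range (d + 1), ((m.factorial : ℂ)⁻¹) *
      (∑ a : Modes p q n, z (sysMode a) * z (refMode a.swap)) ^ m := by
  rw [maxEntangled, polyState_apply, map_sum]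
  refine Finset.sum_congr rfl fun m _ => ?_
  simp only [map_sum, map_mul, map_pow, map_add, Zvar, MvPolynomial.eval_C, MvPolynomial.eval_X]
  rw [Fintype.sum_sum_type, Fintype.sum_prod_type_right, Fintype.sum_prod_type_right]
  congr 3
  refine Finset.sum_congr rfl fun j _ => Finset.sum_congr rfl fun k _ => ?_
  exact mul_comm _ _

theorem tmul_basisState_swapState (α : Modes p q n → ℕ) (z : Modes (p + q) (p + q) n → ℂ) :
    tmul (basisState α) (swapState α) z =
      (multiFactorial α : ℂ)⁻¹ * ∏ a, (z (sysMode a) * z (refMode a.swap)) ^ α a := by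
  have h : multiFactorial (α ∘ Sum.swap : Modes q p n → ℕ) = multiFactorial α :=
    (Equiv.sumComm (Fin n × Fin q) (Fin n × Fin p)).prod_comp fun a => (α a).factorial
  have h2 : ∏ a : Modes q p n, z (refMode a) ^ α a.swap = ∏ a, z (refMode a.swap) ^ α a := by
    rw [← (Equiv.sumComm (Fin n × Fin q) (Fin n × Fin p)).prod_comp]
    simp
  rw [tmul_apply, swapState, basisState, basisState, sb_smul_apply, sb_smul_apply,
    monoState_apply, monoState_apply, h]
  simp only [Function.comp_apply]
  rw [h2]
  simp only [mul_pow, Finset.prod_mul_distrib]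
  rw [← sqrt_multiFactorial_mul_self, mul_inv]
  ring

theorem sum_pow_sum_div_factorial {ι : Type} [Fintype ι] (x : ι → ℂ) (d : ℕ) :
    ∑ m ∈ Finset.range (d + 1), (m.factorial : ℂ)⁻¹ * (∑ i, x i) ^ m =
      ∑ α ∈ multiLE ι d, (multiFactorial α : ℂ)⁻¹ * ∏ i, x i ^ α i := by
  let _ := Classical.decEq ι
  rw [multiLE, Finset.sum_biUnion]
  · refine Finset.sum_congr rfl fun m _ => ?_
    rw [Finset.sum_pow_eq_sum_piAntidiag, Finset.mul_sum]
    refine Finset.sum_congr rfl fun α hα => ?_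
    have h := Nat.multinomial_spec Finset.univ α
    rw [(Finset.mem_piAntidiag.1 hα).1] at h
    have h2 : (multiFactorial α : ℂ) * (Nat.multinomial Finset.univ α : ℂ) = m.factorial := by
      exact_mod_cast h
    have h3 : (multiFactorial α : ℂ) ≠ 0 := by exact_mod_cast (multiFactorial_pos α).ne'
    have h4 : (m.factorial : ℂ) ≠ 0 := by exact_mod_cast m.factorial_ne_zero
    rw [← mul_assoc]
    congr 1
    field_simp
    rw [← h2, mul_comm]
  · intro m _ m' _ hmm
    exact Finset.disjoint_left.2 fun α h h' =>
      hmm ((Finset.mem_piAntidiag.1 h).1.symm.trans (Finset.mem_piAntidiag.1 h').1)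

theorem maxEntangled_eq_sum (d : ℕ) :
    maxEntangled p q n d =
      ∑ α ∈ multiLE (Modes p q n) d, tmul (basisState α) (swapState α) := by
  classical
  refine sb_ext fun z => ?_
  have hsum : ∀ s : Finset (Modes p q n → ℕ),
      (∑ α ∈ s, tmul (basisState α) (swapState α)) z =
        ∑ α ∈ s, tmul (basisState α) (swapState α) z := by
    intro s
    induction s using Finset.induction_on with
    | empty => rfl
    | insert a s ha ih => rw [Finset.sum_insert ha, Finset.sum_insert ha, sb_add_apply, ih]
  rw [hsum, maxEntangled_apply, sum_pow_sum_div_factorial]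
  simp only [tmul_basisState_swapState]

theorem tensorOne_maxEntangled (d : ℕ) (A : Fock p q n →L[ℂ] Fock p q n) :
    tensorOne d A (maxEntangled p q n d) =
      ∑ α ∈ multiLE (Modes p q n) d, tmul (A (basisState α)) (swapState α) := by
  rw [maxEntangled_eq_sum, map_sum]
  refine Finset.sum_congr rfl fun α hα => ?_
  rw [tensorOne_tmul, starProjection_basisState hα]

/-! ### The action of the unitary group -/

theorem W_tmul (u : Matrix.unitaryGroup (Fin n) ℂ) (f : Fock p q n) (g : Fock q p n) :
    W (p + q) (p + q) u (tmul f g) = tmul (W p q u f) (W q p u g) := by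
  refine sb_ext fun z => ?_
  rw [W_apply, tmul_apply, tmul_apply, W_apply, W_apply]
  congr 2
  · funext a; rcases a with a | a <;> rfl
  · funext a; rcases a with a | a <;> rfl

theorem W_maxEntangled (u : Matrix.unitaryGroup (Fin n) ℂ) (d : ℕ) :
    W (p + q) (p + q) u (maxEntangled p q n d) = maxEntangled p q n d := by
  refine sb_ext fun z => ?_
  have key : ∀ x y : Fin n → ℂ,
      ∑ k, (u : Matrix (Fin n) (Fin n) ℂ).mulVec x k * (conjMat u).mulVec y k = ∑ k, x k * y k := by
    intro x y
    have h : ∑ k, (u : Matrix (Fin n) (Fin n) ℂ).mulVec x k * (conjMat u).mulVec y k =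
        dotProduct ((u : Matrix (Fin n) (Fin n) ℂ).mulVec x) ((conjMat u).mulVec y) := rfl
    have h2 : (u : Matrix (Fin n) (Fin n) ℂ).transpose * conjMat u = 1 := by
      have h3 := congrArg Matrix.transpose (Matrix.mem_unitaryGroup_iff'.1 u.2)
      rw [Matrix.transpose_mul, Matrix.transpose_one] at h3
      have h4 : (star (u : Matrix (Fin n) (Fin n) ℂ)).transpose = conjMat u := by
        ext i j; rfl
      rwa [h4] at h3
    rw [h, Matrix.dotProduct_mulVec, Matrix.vecMul_mulVec, h2, Matrix.vecMul_one]
    rfl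
  rw [W_apply, maxEntangled_apply, maxEntangled_apply]
  refine Finset.sum_congr rfl fun m _ => ?_
  congr 2
  rw [Fintype.sum_sum_type, Fintype.sum_prod_type_right, Fintype.sum_prod_type_right,
    Fintype.sum_sum_type, Fintype.sum_prod_type_right, Fintype.sum_prod_type_right]
  congr 1
  · exact Finset.sum_congr rfl fun i _ => key
      (fun k => z (Sum.inl (k, Fin.castAdd q i))) (fun k => z (Sum.inr (k, Fin.addNat i q)))
  · refine Finset.sum_congr rfl fun j _ => ?_
    have h := key (fun k => z (Sum.inl (k, Fin.natAdd p j)))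
      (fun k => z (Sum.inr (k, Fin.castLE (Nat.le_add_left q p) j)))
    refine (Finset.sum_congr rfl fun k _ => mul_comm _ _).trans
      (h.trans (Finset.sum_congr rfl fun k _ => mul_comm _ _))

theorem compUnitary_mem_degreeLE {ι : Type} [Fintype ι] (L : (ι → ℂ) ≃ₗ[ℂ] (ι → ℂ))
    (hL : ∀ z, ∑ i, ‖L z i‖ ^ 2 = ∑ i, ‖z i‖ ^ 2) {d : ℕ} {f : SBSpace ι}
    (hf : f ∈ degreeLE ι d) : compUnitary L hL f ∈ degreeLE ι d := by
  classical
  refine degreeLE_le (V := (degreeLE ι d).comap (compUnitary L hL).toLinearEquiv.toLinearMap)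
    (fun α hα => ?_) hf
  let lin : ι → MvPolynomial ι ℂ := fun a =>
    ∑ b, MvPolynomial.C (L (Pi.single b 1) a) * MvPolynomial.X b
  have hlin : ∀ a, (lin a).totalDegree ≤ 1 := fun a => by
    refine MvPolynomial.totalDegree_finsetSum_le fun b _ => ?_
    refine (MvPolynomial.totalDegree_mul _ _).trans ?_
    simp
  have heval : ∀ z a, MvPolynomial.eval z (lin a) = L z a := fun z a => by
    have h := congrFun (LinearMap.pi_apply_eq_sum_univ L.toLinearMap z) a
    simp only [LinearEquiv.coe_coe, Finset.sum_apply, Pi.smul_apply, smul_eq_mul] at h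
    rw [h]
    simp only [lin, map_sum, map_mul, MvPolynomial.eval_C, MvPolynomial.eval_X]
    refine Finset.sum_congr rfl fun b _ => ?_
    rw [mul_comm]
    have hb : (Pi.single b 1 : ι → ℂ) = fun c => if b = c then 1 else 0 := by
      funext c
      simp [Pi.single_apply, eq_comm]
    rw [hb]
  have hdeg : (∏ a, lin a ^ α a) ∈ MvPolynomial.restrictTotalDegree ι ℂ d := by
    rw [MvPolynomial.mem_restrictTotalDegree]
    refine (MvPolynomial.totalDegree_finsetProd _ _).trans (le_trans ?_ (mem_multiLE.1 hα))
    refine Finset.sum_le_sum fun i _ => (MvPolynomial.totalDegree_pow _ _).trans ?_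
    exact (Nat.mul_le_mul_left _ (hlin i)).trans_eq (mul_one _)
  have h : compUnitary L hL (basisState α) =
      ((Real.sqrt (multiFactorial α))⁻¹ : ℂ) • polyState ι (∏ a, lin a ^ α a) := by
    refine sb_ext fun z => ?_
    change basisState α (L z) = _
    rw [basisState, sb_smul_apply, sb_smul_apply, monoState_apply, polyState_apply]
    simp only [map_prod, map_pow, heval]
  rw [Submodule.mem_comap]
  change compUnitary L hL (basisState α) ∈ _
  rw [h]
  exact Submodule.smul_mem _ _ (Submodule.mem_map_of_mem hdeg)

theorem W_mem_degreeLE (u : Matrix.unitaryGroup (Fin n) ℂ) {d : ℕ} {f : Fock p q n}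
    (hf : f ∈ degreeLE (Modes p q n) d) : W p q u f ∈ degreeLE (Modes p q n) d :=
  compUnitary_mem_degreeLE _ _ hf

/-- `(A ⊗ 1) Φ^{≤d}` is symmetric if `A` commutes with the action of the unitary group. -/
theorem W_tensorOne_maxEntangled (u : Matrix.unitaryGroup (Fin n) ℂ) (d : ℕ)
    {A : Fock p q n →L[ℂ] Fock p q n} (hA : ∀ f, W p q u (A f) = A (W p q u f)) :
    W (p + q) (p + q) u (tensorOne d A (maxEntangled p q n d)) =
      tensorOne d A (maxEntangled p q n d) := by
  conv_rhs => rw [← W_maxEntangled u d, maxEntangled_eq_sum, map_sum, map_sum]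
  rw [tensorOne_maxEntangled, map_sum]
  refine Finset.sum_congr rfl fun α hα => ?_
  rw [W_tmul, W_tmul, tensorOne_tmul, hA, Submodule.starProjection_eq_self_iff.2
    (W_mem_degreeLE u (basisState_mem_degreeLE hα))]

end Tensor

/-! ### Square roots of positive operators -/

section Operators

variable {E : Type} [NormedAddCommGroup E] [InnerProductSpace ℂ E]

theorem IsPositiveSqrt.inner_apply {S T : E →L[ℂ] E} (h : IsPositiveSqrt S T) (x y : E) :
    inner ℂ (S x) (S y) = inner ℂ x (T y) := by
  rw [← h.2, ContinuousLinearMap.comp_apply]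
  exact h.1.isSymmetric x (S y)

theorem IsPositiveSqrt.norm_sq {S T : E →L[ℂ] E} (h : IsPositiveSqrt S T) (x : E) :
    ((‖S x‖ ^ 2 : ℝ) : ℂ) = inner ℂ x (T x) := by
  rw [← h.inner_apply, inner_self_eq_norm_sq_to_K]
  push_cast
  rfl

variable [CompleteSpace E]

/-- The positive square root of an operator. -/
def opSqrt (T : E →L[ℂ] E) : E →L[ℂ] E := CFC.sqrt T

theorem isPositiveSqrt_opSqrt {T : E →L[ℂ] E} (h : T.IsPositive) :
    IsPositiveSqrt (opSqrt T) T :=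
  ⟨(ContinuousLinearMap.nonneg_iff_isPositive _).1 (CFC.sqrt_nonneg T),
    CFC.sqrt_mul_sqrt_self T ((ContinuousLinearMap.nonneg_iff_isPositive _).2 h)⟩

theorem IsPositiveSqrt.eq_opSqrt {S T : E →L[ℂ] E} (h : IsPositiveSqrt S T) : opSqrt T = S :=
  CFC.sqrt_unique h.2 ((ContinuousLinearMap.nonneg_iff_isPositive _).2 h.1)

theorem tendsto_opSqrt {T : ℕ → E →L[ℂ] E} {T₀ : E →L[ℂ] E} (hT : ∀ d, (T d).IsPositive)
    (hT₀ : T₀.IsPositive) (h : Tendsto T atTop (𝓝 T₀)) :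
    Tendsto (fun d => opSqrt (T d)) atTop (𝓝 (opSqrt T₀)) := by
  have hc : ContinuousOn (fun A : E →L[ℂ] E => cfcₙ NNReal.sqrt A) {A | 0 ≤ A} :=
    ContinuousOn.cfcₙ_nnreal_of_mem_nhdsSet (s := Set.univ) NNReal.sqrt Filter.univ_mem
      continuousOn_id (fun _ h => h) NNReal.continuous_sqrt.continuousOn NNReal.sqrt_zero
  exact (hc T₀ ((ContinuousLinearMap.nonneg_iff_isPositive _).2 hT₀)).tendsto.comp
    (tendsto_nhdsWithin_iff.2 ⟨h, .of_forall fun d =>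
      (ContinuousLinearMap.nonneg_iff_isPositive _).2 (hT d)⟩)

theorem tendsto_adjoint_comp_self {A : ℕ → E →L[ℂ] E} {B : E →L[ℂ] E}
    (h : Tendsto A atTop (𝓝 B)) :
    Tendsto (fun d => (A d).adjoint ∘L A d) atTop (𝓝 (B.adjoint ∘L B)) :=
  ((ContinuousLinearMap.adjoint.continuous.tendsto B).comp h).mul h

/-- The operator norm is bounded by the Hilbert-Schmidt norm. -/
theorem norm_sq_le_tsum {I : Type} (b : HilbertBasis I ℂ E) (T : E →L[ℂ] E)
    (hT : Summable fun i => ‖T (b i)‖ ^ 2) : ‖T‖ ^ 2 ≤ ∑' i, ‖T (b i)‖ ^ 2 := by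
  have h0 : 0 ≤ ∑' i, ‖T (b i)‖ ^ 2 := tsum_nonneg fun _ => by positivity
  rw [← Real.le_sqrt (norm_nonneg _) h0, ← LinearIsometryEquiv.norm_map ContinuousLinearMap.adjoint]
  refine ContinuousLinearMap.opNorm_le_bound _ (Real.sqrt_nonneg _) fun y => ?_
  have h1 : HasSum (fun i => ‖inner ℂ (T (b i)) y‖ ^ 2) (‖T.adjoint y‖ ^ 2) := by
    have h := b.hasSum_inner_mul_inner (T.adjoint y) (T.adjoint y)
    rw [inner_self_eq_norm_sq_to_K] at h
    have h2 : ∀ i, inner ℂ (T.adjoint y) (b i) * inner ℂ (b i) (T.adjoint y) =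
        ((‖inner ℂ (T (b i)) y‖ ^ 2 : ℝ) : ℂ) := fun i => by
      rw [← inner_conj_symm, ContinuousLinearMap.adjoint_inner_right, Complex.conj_mul']
      push_cast
      rfl
    simp only [h2] at h
    have h3 : ((‖T.adjoint y‖ : ℂ)) ^ 2 = ((‖T.adjoint y‖ ^ 2 : ℝ) : ℂ) := by push_cast; rfl
    exact Complex.hasSum_ofReal.1 (h3 ▸ h)
  have h2 : ‖T.adjoint y‖ ^ 2 ≤ (∑' i, ‖T (b i)‖ ^ 2) * ‖y‖ ^ 2 := by
    refine hasSum_le (fun i => ?_) h1 (hT.hasSum.mul_right _)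
    rw [← mul_pow]
    exact pow_le_pow_left₀ (norm_nonneg _) (norm_inner_le_norm _ _) 2
  have h3 := Real.sqrt_le_sqrt h2
  rwa [Real.sqrt_sq (norm_nonneg _), Real.sqrt_mul h0, Real.sqrt_sq (norm_nonneg _)] at h3

end Operators

/-! ### Vectorization of Hilbert-Schmidt operators -/

section Vectorize

variable {p q n : ℕ}

theorem tendsto_multiLE (ι : Type) [Fintype ι] : Tendsto (multiLE ι) atTop atTop :=
  tendsto_atTop_finset_of_monotone
    (fun _ _ h _ hα => mem_multiLE.2 ((mem_multiLE.1 hα).trans h))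
    fun α => ⟨∑ i, α i, mem_multiLE.2 le_rfl⟩

/-- The isometry `f ↦ f ⊗ e_α`. -/
def tensorSwap (α : Modes p q n → ℕ) : Fock p q n →ₗᵢ[ℂ] Fock (p + q) (p + q) n where
  toLinearMap := (tensorRight (swapState α)).toLinearMap
  norm_map' f := by
    change ‖tmul f (swapState α)‖ = _
    rw [norm_tmul, norm_swapState, mul_one]

theorem tensorSwap_apply (α : Modes p q n → ℕ) (f : Fock p q n) :
    tensorSwap α f = tmul f (swapState α) := rfl

theorem orthogonalFamily_tensorSwap :
    OrthogonalFamily ℂ (fun _ : Modes p q n → ℕ => Fock p q n) tensorSwap := by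
  intro α β h f g
  rw [tensorSwap_apply, tensorSwap_apply, inner_tmul, inner_swapState, if_neg h, mul_zero]

/-- The images of the monomial basis under a Hilbert-Schmidt operator. -/
def columns (A : Fock p q n →L[ℂ] Fock p q n)
    (hA : Summable fun α => ‖A (basisState α)‖ ^ 2) :
    lp (fun _ : Modes p q n → ℕ => Fock p q n) 2 :=
  ⟨fun α => A (basisState α), memℓp_gen (by simpa using hA)⟩

theorem columns_apply (A : Fock p q n →L[ℂ] Fock p q n)
    (hA : Summable fun α => ‖A (basisState α)‖ ^ 2) (α : Modes p q n → ℕ) :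
    columns A hA α = A (basisState α) := rfl

/-- The vector `(A ⊗ 1) Φ = ∑_α A e_α ⊗ e_α` of a Hilbert-Schmidt operator `A`. -/
def vectorize (A : Fock p q n →L[ℂ] Fock p q n)
    (hA : Summable fun α => ‖A (basisState α)‖ ^ 2) : Fock (p + q) (p + q) n :=
  (orthogonalFamily_tensorSwap (p := p) (q := q) (n := n)).linearIsometry (columns A hA)

theorem hasSum_vectorize (A : Fock p q n →L[ℂ] Fock p q n)
    (hA : Summable fun α => ‖A (basisState α)‖ ^ 2) :
    HasSum (fun α => tmul (A (basisState α)) (swapState α)) (vectorize A hA) :=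
  orthogonalFamily_tensorSwap.hasSum_linearIsometry (columns A hA)

theorem tendsto_tensorOne_maxEntangled (A : Fock p q n →L[ℂ] Fock p q n)
    (hA : Summable fun α => ‖A (basisState α)‖ ^ 2) :
    Tendsto (fun d => tensorOne d A (maxEntangled p q n d)) atTop (𝓝 (vectorize A hA)) := by
  simp only [tensorOne_maxEntangled]
  exact (hasSum_vectorize A hA).comp (tendsto_multiLE _)

theorem norm_vectorize_sub (A B : Fock p q n →L[ℂ] Fock p q n)
    (hA : Summable fun α => ‖A (basisState α)‖ ^ 2)
    (hB : Summable fun α => ‖B (basisState α)‖ ^ 2) :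
    ‖vectorize A hA - vectorize B hB‖ ^ 2 =
      ∑' α, ‖A (basisState α) - B (basisState α)‖ ^ 2 := by
  rw [vectorize, vectorize, ← map_sub, LinearIsometry.norm_map]
  have h := lp.norm_rpow_eq_tsum (p := 2) (by norm_num) (columns A hA - columns B hB)
  simpa [columns_apply] using h

theorem vectorize_eq_tensorOne (d : ℕ) (A : Fock p q n →L[ℂ] Fock p q n)
    (hA : Summable fun α => ‖A (basisState α)‖ ^ 2)
    (h0 : ∀ α, α ∉ multiLE (Modes p q n) d → A (basisState α) = 0) :
    vectorize A hA = tensorOne d A (maxEntangled p q n d) := by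
  rw [tensorOne_maxEntangled]
  refine (hasSum_vectorize A hA).unique (hasSum_sum_of_ne_finset_zero fun α hα => ?_)
  rw [h0 α hα, ← tensorRight_apply, map_zero]

/-- Dominated convergence for vectorizations. -/
theorem tendsto_vectorize {A : ℕ → Fock p q n →L[ℂ] Fock p q n} {B : Fock p q n →L[ℂ] Fock p q n}
    (hA : ∀ d, Summable fun α => ‖A d (basisState α)‖ ^ 2)
    (hB : Summable fun α => ‖B (basisState α)‖ ^ 2)
    (hle : ∀ d α, ‖A d (basisState α)‖ ≤ ‖B (basisState α)‖)
    (hlim : ∀ α, Tendsto (fun d => A d (basisState α)) atTop (𝓝 (B (basisState α)))) :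
    Tendsto (fun d => vectorize (A d) (hA d)) atTop (𝓝 (vectorize B hB)) := by
  rw [tendsto_iff_norm_sub_tendsto_zero]
  have h : Tendsto (fun d => ‖vectorize (A d) (hA d) - vectorize B hB‖ ^ 2) atTop (𝓝 0) := by
    simp only [norm_vectorize_sub]
    rw [← tsum_zero (α := ℝ) (β := Modes p q n → ℕ)]
    refine tendsto_tsum_of_dominated_convergence (hB.mul_left 4) (fun α => ?_)
      (.of_forall fun d α => ?_)
    · have h1 := (tendsto_iff_norm_sub_tendsto_zero.1 (hlim α)).pow 2
      simpa using h1
    · rw [Real.norm_of_nonneg (by positivity)]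
      have h1 := norm_sub_le (A d (basisState α)) (B (basisState α))
      have h2 := hle d α
      nlinarith [norm_nonneg (A d (basisState α) - B (basisState α))]
  have h2 := h.sqrt
  simpa only [Real.sqrt_sq (norm_nonneg _), Real.sqrt_zero] using h2

theorem inner_tmul_vectorize (A : Fock p q n →L[ℂ] Fock p q n)
    (hA : Summable fun α => ‖A (basisState α)‖ ^ 2) (f : Fock p q n) (α : Modes p q n → ℕ) :
    inner ℂ (tmul f (swapState α)) (vectorize A hA) = inner ℂ f (A (basisState α)) := by
  have h := (hasSum_vectorize A hA).mapL (innerSL ℂ (tmul f (swapState α)))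
  simp only [innerSL_apply_apply, inner_tmul, inner_swapState] at h
  refine h.unique ?_
  convert hasSum_single (L := .unconditional _) α fun β hβ => ?_ using 1
  · simp
  · simp [Ne.symm hβ]

theorem isPurification_vectorize {S ρ : Fock p q n →L[ℂ] Fock p q n} (h : IsPositiveSqrt S ρ)
    (hS : Summable fun α => ‖S (basisState α)‖ ^ 2) : IsPurification (vectorize S hS) ρ := by
  intro I b f g
  set ψ := vectorize S hS
  have h1 := b.hasSum_inner_mul_inner ((tensorLeft g).adjoint ψ) ((tensorLeft f).adjoint ψ)
  have h2 : inner ℂ ((tensorLeft g).adjoint ψ) ((tensorLeft f).adjoint ψ) = inner ℂ f (ρ g) := by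
    rw [← h.inner_apply]
    have h3 := (monoBasis (Modes q p n)).hasSum_inner_mul_inner ((tensorLeft g).adjoint ψ)
      ((tensorLeft f).adjoint ψ)
    let e : (Modes p q n → ℕ) ≃ (Modes q p n → ℕ) :=
      (Equiv.sumComm (Fin n × Fin p) (Fin n × Fin q)).arrowCongr (Equiv.refl ℕ)
    rw [← e.hasSum_iff] at h3
    refine h3.unique ?_
    have h4 := (monoBasis (Modes p q n)).hasSum_inner_mul_inner (S f) (S g)
    convert h4 using 2 with α
    have he : monoBasis (Modes q p n) (e α) = swapState α := monoBasis_apply _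
    have hg : inner ℂ ψ (tmul g (swapState α)) = inner ℂ (basisState α) (S g) := by
      rw [← inner_conj_symm, inner_tmul_vectorize, inner_conj_symm]
      exact h.1.isSymmetric _ _
    have hf : inner ℂ (tmul f (swapState α)) ψ = inner ℂ (S f) (basisState α) := by
      rw [inner_tmul_vectorize]
      exact (h.1.isSymmetric _ _).symm
    rw [Function.comp_apply, he, ContinuousLinearMap.adjoint_inner_left,
      ContinuousLinearMap.adjoint_inner_right, tensorLeft_apply, tensorLeft_apply, hg, hf,
      monoBasis_apply, mul_comm]
  rw [h2] at h1
  have h5 : ∀ i, inner ℂ (tmul f (b i)) (InnerProductSpace.rankOne ℂ ψ ψ (tmul g (b i))) =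
      inner ℂ ((tensorLeft g).adjoint ψ) (b i) * inner ℂ (b i) ((tensorLeft f).adjoint ψ) := by
    intro i
    rw [InnerProductSpace.rankOne_apply, inner_smul_right, ContinuousLinearMap.adjoint_inner_left,
      ContinuousLinearMap.adjoint_inner_right, tensorLeft_apply, tensorLeft_apply]
  simpa only [h5] using h1

end Vectorize

/-! ### Truncations of a density operator -/

section Truncation

variable {p q n : ℕ} {ρ : Fock p q n →L[ℂ] Fock p q n}

theorem isPositive_truncate (h : ρ.IsPositive) (d : ℕ) : (truncate d ρ).IsPositive :=
  h.conj_starProjection _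

theorem inner_truncate (d : ℕ) (x y : Fock p q n) :
    inner ℂ x (truncate d ρ y) = inner ℂ ((degreeLE (Modes p q n) d).starProjection x)
      (ρ ((degreeLE (Modes p q n) d).starProjection y)) :=
  ((degreeLE (Modes p q n) d).starProjection_isSymmetric x _).symm

theorem norm_sqrt_truncate_apply (h : ρ.IsPositive) (d : ℕ) (x : Fock p q n) :
    ‖opSqrt (truncate d ρ) x‖ =
      ‖opSqrt ρ ((degreeLE (Modes p q n) d).starProjection x)‖ := by
  have h1 := (isPositiveSqrt_opSqrt (isPositive_truncate h d)).norm_sq x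
  rw [inner_truncate, ← (isPositiveSqrt_opSqrt h).norm_sq, Complex.ofReal_inj] at h1
  exact (pow_left_inj₀ (norm_nonneg _) (norm_nonneg _) two_ne_zero).1 h1

theorem sqrt_truncate_starProjection (h : ρ.IsPositive) (d : ℕ) (x : Fock p q n) :
    opSqrt (truncate d ρ) ((degreeLE (Modes p q n) d).starProjection x) =
      opSqrt (truncate d ρ) x := by
  rw [← sub_eq_zero, ← map_sub, ← norm_eq_zero, norm_sqrt_truncate_apply h, map_sub,
    Submodule.starProjection_eq_self_iff.2 (Submodule.starProjection_apply_mem _ _), sub_self,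
    map_zero, norm_zero]

theorem isTensorOne_sqrt_truncate (h : ρ.IsPositive) (d : ℕ) :
    IsTensorOne (opSqrt (truncate d ρ)) (tensorOne d (opSqrt (truncate d ρ))) := fun f g => by
  rw [tensorOne_tmul, sqrt_truncate_starProjection h]

theorem sqrt_truncate_basisState_eq_zero (h : ρ.IsPositive) {d : ℕ} {α : Modes p q n → ℕ}
    (hα : α ∉ multiLE (Modes p q n) d) : opSqrt (truncate d ρ) (basisState α) = 0 := by
  rw [← norm_eq_zero, norm_sqrt_truncate_apply h, starProjection_basisState_of_notMem hα,
    map_zero, norm_zero]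

theorem norm_sqrt_truncate_basisState_le (h : ρ.IsPositive) (d : ℕ) (α : Modes p q n → ℕ) :
    ‖opSqrt (truncate d ρ) (basisState α)‖ ≤ ‖opSqrt ρ (basisState α)‖ := by
  by_cases hα : α ∈ multiLE (Modes p q n) d
  · rw [norm_sqrt_truncate_apply h, starProjection_basisState hα]
  · rw [sqrt_truncate_basisState_eq_zero h hα, norm_zero]
    exact norm_nonneg _

theorem summable_norm_sqrt_basisState (h : IsDensity ρ) :
    Summable fun α : Modes p q n → ℕ => ‖opSqrt ρ (basisState α)‖ ^ 2 := by
  have h1 := (h.2 _ (monoBasis (Modes p q n))).summable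
  simp only [monoBasis_apply, ← (isPositiveSqrt_opSqrt h.1).norm_sq] at h1
  exact Complex.summable_ofReal.1 h1

theorem tendsto_comp_starProjection (A : Fock p q n →L[ℂ] Fock p q n)
    (hA : Summable fun α => ‖A (basisState α)‖ ^ 2) :
    Tendsto (fun d => A ∘L (degreeLE (Modes p q n) d).starProjection) atTop (𝓝 A) := by
  rw [tendsto_iff_norm_sub_tendsto_zero]
  have hle : ∀ d α, ‖(A ∘L (degreeLE (Modes p q n) d).starProjection - A) (basisState α)‖ ≤
      ‖A (basisState α)‖ := fun d α => by
    rw [sub_apply, ContinuousLinearMap.comp_apply]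
    by_cases hα : α ∈ multiLE (Modes p q n) d
    · simp [starProjection_basisState hα]
    · simp [starProjection_basisState_of_notMem hα]
  have hle2 : ∀ d α,
      ‖(A ∘L (degreeLE (Modes p q n) d).starProjection - A) (basisState α)‖ ^ 2 ≤
        ‖A (basisState α)‖ ^ 2 := fun d α => pow_le_pow_left₀ (norm_nonneg _) (hle d α) 2
  have hs : ∀ d, Summable fun α =>
      ‖(A ∘L (degreeLE (Modes p q n) d).starProjection - A) (basisState α)‖ ^ 2 := fun d =>
    hA.of_nonneg_of_le (fun _ => by positivity) (hle2 d)
  have h1 : Tendsto (fun d => ∑' α,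
      ‖(A ∘L (degreeLE (Modes p q n) d).starProjection - A) (basisState α)‖ ^ 2) atTop
      (𝓝 0) := by
    rw [← tsum_zero (α := ℝ) (β := Modes p q n → ℕ)]
    refine tendsto_tsum_of_dominated_convergence hA (fun α => ?_)
      (.of_forall fun d α => by rw [Real.norm_of_nonneg (by positivity)]; exact hle2 d α)
    refine tendsto_const_nhds.congr' ?_
    filter_upwards [eventually_ge_atTop (∑ i, α i)] with d hd
    rw [sub_apply, ContinuousLinearMap.comp_apply, starProjection_basisState (mem_multiLE.2 hd)]
    simp
  have h2 : Tendsto (fun d => ‖A ∘L (degreeLE (Modes p q n) d).starProjection - A‖ ^ 2) atTop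
      (𝓝 0) := by
    refine squeeze_zero (fun _ => by positivity) (fun d => ?_) h1
    have h3 := norm_sq_le_tsum (monoBasis (Modes p q n))
      (A ∘L (degreeLE (Modes p q n) d).starProjection - A)
    simp only [monoBasis_apply] at h3
    exact h3 (hs d)
  have h4 := h2.sqrt
  simpa only [Real.sqrt_sq (norm_nonneg _), Real.sqrt_zero] using h4

theorem adjoint_comp_starProjection_eq_truncate (h : ρ.IsPositive) (d : ℕ) :
    (opSqrt ρ ∘L (degreeLE (Modes p q n) d).starProjection).adjoint ∘L
      (opSqrt ρ ∘L (degreeLE (Modes p q n) d).starProjection) = truncate d ρ := by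
  refine ContinuousLinearMap.ext fun x => ext_inner_left ℂ fun y => ?_
  rw [inner_truncate, ← (isPositiveSqrt_opSqrt h).inner_apply, ContinuousLinearMap.comp_apply,
    ContinuousLinearMap.adjoint_inner_right]
  rfl

theorem adjoint_opSqrt_comp_self (h : ρ.IsPositive) :
    (opSqrt ρ).adjoint ∘L opSqrt ρ = ρ := by
  refine ContinuousLinearMap.ext fun x => ext_inner_left ℂ fun y => ?_
  rw [← (isPositiveSqrt_opSqrt h).inner_apply, ContinuousLinearMap.comp_apply,
    ContinuousLinearMap.adjoint_inner_right]

theorem tendsto_truncate (h : IsDensity ρ) : Tendsto (fun d => truncate d ρ) atTop (𝓝 ρ) := by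
  have h1 := tendsto_adjoint_comp_self
    (tendsto_comp_starProjection (opSqrt ρ) (summable_norm_sqrt_basisState h))
  simpa only [adjoint_comp_starProjection_eq_truncate h.1, adjoint_opSqrt_comp_self h.1] using h1

theorem sqrt_commute_W (h : ρ.IsPositive) (hinv : IsInvariant ρ)
    (u : Matrix.unitaryGroup (Fin n) ℂ) (f : Fock p q n) :
    W p q u (opSqrt ρ f) = opSqrt ρ (W p q u f) := by
  set S := opSqrt ρ
  have hsq := isPositiveSqrt_opSqrt h
  let U : Fock p q n →L[ℂ] Fock p q n := (W p q u : Fock p q n →L[ℂ] Fock p q n)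
  have hU : U.adjoint = ((W p q u).symm : Fock p q n →L[ℂ] Fock p q n) :=
    (W p q u).adjoint_eq_symm
  have hS : IsPositiveSqrt (U ∘L S ∘L U.adjoint) ρ := by
    refine ⟨hsq.1.conj_adjoint U, ContinuousLinearMap.ext fun x => ?_⟩
    rw [hU, ← hinv u x]
    change W p q u (S ((W p q u).symm (W p q u (S ((W p q u).symm x))))) = _
    rw [LinearIsometryEquiv.symm_apply_apply]
    exact congrArg (W p q u) (congrArg (fun T : Fock p q n →L[ℂ] Fock p q n =>
      T ((W p q u).symm x)) hsq.2)
  have h1 : S = U ∘L S ∘L U.adjoint := hS.eq_opSqrt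
  have h2 : S (W p q u f) = W p q u (S ((W p q u).symm (W p q u f))) := by
    conv_lhs => rw [h1, hU]
    rfl
  rw [h2, LinearIsometryEquiv.symm_apply_apply]

theorem vectorize_sqrt_mem_symmetricSubspace (h : IsDensity ρ) (hinv : IsInvariant ρ) :
    vectorize (opSqrt ρ) (summable_norm_sqrt_basisState h) ∈
      symmetricSubspace (p + q) (p + q) n := by
  intro u
  have h1 := tendsto_tensorOne_maxEntangled _ (summable_norm_sqrt_basisState h)
  have h2 := ((W (p + q) (p + q) u).continuous.tendsto _).comp h1
  refine tendsto_nhds_unique h2 (h1.congr fun d => ?_)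
  exact (W_tensorOne_maxEntangled u d (sqrt_commute_W h.1 hinv u)).symm

end Truncation

end SegalBargmann

end

open SegalBargmann in
theorem theorem2 (p q n : ℕ) (hp : 1 ≤ p) (hq : 1 ≤ q) (hn : 1 ≤ n)
    (ρ : Fock p q n →L[ℂ] Fock p q n) (hρ : IsDensity ρ) (hinv : IsInvariant ρ) :
    ∃ ψ ∈ symmetricSubspace (p + q) (p + q) n, IsPurification ψ ρ ∧
      ∃ (S : ℕ → Fock p q n →L[ℂ] Fock p q n)
        (T : ℕ → Fock (p + q) (p + q) n →L[ℂ] Fock (p + q) (p + q) n),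
        (∀ d, IsPositiveSqrt (S d) (truncate d ρ)) ∧
        (∀ d, IsTensorOne (S d) (T d)) ∧
        Filter.Tendsto (fun d => T d (maxEntangled p q n d)) Filter.atTop (nhds ψ) := by
  have hsum := summable_norm_sqrt_basisState hρ
  have hle := norm_sqrt_truncate_basisState_le hρ.1
  have hsum' : ∀ d, Summable fun α : Modes p q n → ℕ =>
      ‖opSqrt (truncate d ρ) (basisState α)‖ ^ 2 := fun d =>
    hsum.of_nonneg_of_le (fun _ => by positivity)
      fun α => pow_le_pow_left₀ (norm_nonneg _) (hle d α) 2
  refine ⟨vectorize (opSqrt ρ) hsum, vectorize_sqrt_mem_symmetricSubspace hρ hinv,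
    isPurification_vectorize (isPositiveSqrt_opSqrt hρ.1) hsum,
    fun d => opSqrt (truncate d ρ), fun d => tensorOne d (opSqrt (truncate d ρ)),
    fun d => isPositiveSqrt_opSqrt (isPositive_truncate hρ.1 d),
    isTensorOne_sqrt_truncate hρ.1, ?_⟩
  have hlim := tendsto_opSqrt (isPositive_truncate hρ.1) hρ.1 (tendsto_truncate hρ)
  refine (tendsto_vectorize hsum' hsum hle fun α => ?_).congr fun d =>
    vectorize_eq_tensorOne d _ (hsum' d) fun α hα => sqrt_truncate_basisState_eq_zero hρ.1 hα
  exact ((ContinuousLinearMap.apply ℂ (Fock p q n) (basisState α)).continuous.tendsto _).comp hlim
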